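/- Setting. Consider an episodic MDP with finite nonempty state space $\mathcal S$ and action space $\mathcal A$, $S=|\mathcal S|$, $A=|\mathcal A|$, horizon $H\ge 1$, transition kernels $P_h(\cdot\mid s,a)$ and deterministic rewards $r_h:\mathcal S\times\mathcal A\to[0,1]$, $h\in[H]$. A policy $\pi=(\pi_h)_{h\in[H]}$ consists of maps $\pi_h:\mathcal S\to\mathcal A$. For a risk parameter $\beta\neq 0$ let $$V_1^{\pi}(s)=\frac1\beta\log \mathbb E\Big[\exp\Big(\beta\sum_{h=1}^H r_h(s_h,\pi_h(s_h))\Big)\,\Big|\,s_1=s\Big],\qquad V_1^*(s)=\sup_\pi V_1^\pi(s).$$ In each of $K\ge 1$ episodes $k$ the environment chooses an initial state $s_1^k$ arbitrarily (possibly at random and depending on the past episodes), and the agent executes a policy $\pi^k$. Put $\mathrm{Regret}(K)=\sum_{k=1}^K [V_1^*(s_1^k)-V_1^{\pi^k}(s_1^k)]$ and $T=KH$. Algorithm RSVI, with confidence level $\delta\in(0,1]$ and bonus constant $c_\gamma>0$. Let $N_h(s,a)$ be the number of episodes $\tau<k$ with $(s_h^\tau,a_h^\tau)=(s,a)$. Before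 episode $k$, set $V_{H+1}=0$ and for $h=H,\dots,1$ let $$w_h\in\arg\min_{w\in\mathbb R^{\mathcal S\times\mathcal A}}\sum_{\tau<k}\Big[e^{\beta[r_h(s_h^\tau,a_h^\tau)+V_{h+1}(s_{h+1}^\tau)]}-w(s_h^\tau,a_h^\tau)\Big]^2 .$$ If $N_h(s,a)=0$, let $Q_h(s,a)=H-h+1$; otherwise, with $b_h(s,a)=c_\gamma|e^{\beta H}-1|\sqrt{S\log(2SAT/\delta)/N_h(s,a)}$, let $$Q_h(s,a)=\begin{cases}\frac1\beta\log\min\{e^{\beta(H-h+1)},\,w_h(s,a)+b_h(s,a)\},&\beta>0,\\[2pt] \frac1\beta\log\max\{e^{\beta(H-h+1)},\,w_h(s,a)-b_h(s,a)\},&\beta<0.\end{cases}$$ Let $V_h(s)=\max_a Q_h(s,a)$. In episode $k$ the agent plays $\pi_h^k(s)\in\arg\max_a Q_h(s,a)$, ties being broken by any rule. Claim. Let $\lambda(u)=(e^{3u}-1)/u$ for $u>0$. Then $\lim_{\beta\to0}\lambda(|\beta|H^2)=3$ for every $H\ge1$. Moreover there are universal constants $c_\gamma>0$ and $C>0$ such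 that for every $H\ge 1$ there is $\beta_0>0$ (depending only on $H$) such that for all $\beta$ with $0<|\beta|<\beta_0$, all MDPs with horizon $H$ as above, all $K\ge1$, all $\delta\in(0,1]$ and all choices of the environment, with probability at least $1-\delta$ the regret of RSVI with bonus constant $c_\gamma$ satisfies $$\mathrm{Regret}(K)\le C\sqrt{H^3S^2A\,T\,\log^2(2SAT/\delta)} .$$ -/

import Mathlib

open Filter Topology

noncomputable section

namespace RiskRL

/-- A finite-horizon episodic MDP with horizon `H`. Steps are indexed by `Fin H`, so that the
index `h` stands for step `h + 1` of `{1, …, H}`. `P h s a` is the law of the next state and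
`r h s a ∈ [0, 1]` is the deterministic reward. -/
structure EpisodicMDP (S A : Type*) (H : ℕ) where
  P : Fin H → S → A → PMF S
  r : Fin H → S → A → ℝ
  r_nonneg : ∀ h s a, 0 ≤ r h s a
  r_le_one : ∀ h s a, r h s a ≤ 1

/-- Policies: a map from states to actions for every step. -/
abbrev Policy (S A : Type*) (H : ℕ) := Fin H → S → A

/-- Law of the path `(x₀, …, x_H)` of the inhomogeneous Markov chain with transition kernels
`κ 0, …, κ (H - 1)` started at `x₀ = s`. -/
def pathLaw {S : Type*} : (H : ℕ) → (Fin H → S → PMF S) → S → PMF (Fin (H + 1) → S)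
  | 0, _, s => PMF.pure fun _ => s
  | H + 1, κ, s => (κ 0 s).bind fun s' =>
      (pathLaw H (fun h => κ h.succ) s').map fun x => Fin.cons s x

section MDP

variable {S A : Type*} {H : ℕ}

/-- Law of the states `(s₁, …, s_{H+1})` of one episode in which policy `π` is executed from the
initial state `s`. -/
def EpisodicMDP.episodeLaw (M : EpisodicMDP S A H) (π : Policy S A H) (s : S) :
    PMF (Fin (H + 1) → S) :=
  pathLaw H (fun h x => M.P h x (π h x)) s

/-- Cumulative reward along the states `x` when following `π`. -/
def EpisodicMDP.totalReward (M : EpisodicMDP S A H) (π : Policy S A H) (x : Fin (H + 1) → S) : ℝ :=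
  ∑ h : Fin H, M.r h (x h.castSucc) (π h (x h.castSucc))

/-- The risk-sensitive value of `π` from `s` at the first step, under the exponential utility:
`V₁^π(s) = (1/β) log E[exp(β ∑ₕ rₕ(sₕ, πₕ(sₕ))) | s₁ = s]`. -/
def EpisodicMDP.value [Fintype S] (M : EpisodicMDP S A H) (β : ℝ) (π : Policy S A H) (s : S) : ℝ :=
  1 / β * Real.log
    (∑ x : Fin (H + 1) → S, (M.episodeLaw π s x).toReal * Real.exp (β * M.totalReward π x))

/-- The optimal value `V₁^*(s) = sup_π V₁^π(s)` at the first step. -/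
def EpisodicMDP.optValue [Fintype S] (M : EpisodicMDP S A H) (β : ℝ) (s : S) : ℝ :=
  ⨆ π : Policy S A H, M.value β π s

/-- What one episode produces: the policy that was executed and the visited states
`s₁, …, s_{H+1}`. -/
structure Episode (S A : Type*) (H : ℕ) where
  policy : Policy S A H
  state : Fin (H + 1) → S

/-- The state `s_h` at step `h`. -/
def Episode.at (e : Episode S A H) (h : Fin H) : S := e.state h.castSucc

/-- The action `a_h` taken at step `h`. -/
def Episode.action (e : Episode S A H) (h : Fin H) : A := e.policy h (e.at h)

/-- The next state `s_{h+1}` observed after step `h`. -/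
def Episode.next (e : Episode S A H) (h : Fin H) : S := e.state h.succ

open Classical in
/-- `N_h(s, a)`: the number of episodes in which `(s, a)` was the state-action pair at step `h`. -/
def visits {n : ℕ} (D : Fin n → Episode S A H) (h : Fin H) (s : S) (a : A) : ℕ :=
  (Finset.univ.filter fun τ : Fin n => (D τ).at h = s ∧ (D τ).action h = a).card

/-- The least-squares objective at step `h`, for the data `D` of the past episodes and the estimate
`V` of the value at the next step. The vector `w` is indexed by state-action pairs, and its inner
product with the canonical basis vector of `(s, a)` is `w (s, a)`. -/
def lsObjective {n : ℕ} (M : EpisodicMDP S A H) (β : ℝ) (D : Fin n → Episode S A H) (h : Fin H)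
    (V : S → ℝ) (w : S × A → ℝ) : ℝ :=
  ∑ τ : Fin n,
    (Real.exp (β * (M.r h ((D τ).at h) ((D τ).action h) + V ((D τ).next h)))
      - w ((D τ).at h, (D τ).action h)) ^ 2

/-- The logarithmic term `ι = log (2 S A T / δ)` with `T = K H`. -/
def logTerm (S A : Type*) [Fintype S] [Fintype A] (H K : ℕ) (δ : ℝ) : ℝ :=
  Real.log (2 * Fintype.card S * Fintype.card A * ((K : ℝ) * H) / δ)

/-- The exploration bonus `c |e^{βH} - 1| √(S log(2SAT/δ) / N)` for a pair visited `N` times. -/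
def bonus (S A : Type*) [Fintype S] [Fintype A] (H K : ℕ) (c δ β : ℝ) (N : ℕ) : ℝ :=
  c * |Real.exp (β * H) - 1| * √(Fintype.card S * logTerm S A H K δ / N)

/-- The quantities `w_h`, `Q_h` (`h = 1, …, H`) and `V_h` (`h = 1, …, H + 1`) are those that the value
estimation step of RSVI computes from the data `D` of the previous episodes. With the index
`h : Fin H` for step `h + 1`, the number `H - h` below is `H - h + 1` in the numbering of the steps from 1. -/
structure IsRSVIEstimate [Fintype S] [Fintype A] (M : EpisodicMDP S A H) (K : ℕ) (c δ β : ℝ)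
    {n : ℕ} (D : Fin n → Episode S A H)
    (w : Fin H → S × A → ℝ) (Q : Fin H → S → A → ℝ) (V : Fin (H + 1) → S → ℝ) : Prop where
  V_last : ∀ s, V (Fin.last H) s = 0
  w_min : ∀ h, IsMinOn (lsObjective M β D h (V h.succ)) Set.univ (w h)
  Q_unvisited : ∀ h s a, visits D h s a = 0 → Q h s a = (H : ℝ) - (h : ℕ)
  Q_seeking : 0 < β → ∀ h s a, 1 ≤ visits D h s a →
    Q h s a = 1 / β * Real.log (min (Real.exp (β * ((H : ℝ) - (h : ℕ))))
      (w h (s, a) + bonus S A H K c δ β (visits D h s a)))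
  Q_averse : β < 0 → ∀ h s a, 1 ≤ visits D h s a →
    Q h s a = 1 / β * Real.log (max (Real.exp (β * ((H : ℝ) - (h : ℕ))))
      (w h (s, a) - bonus S A H K c δ β (visits D h s a)))
  V_max : ∀ (h : Fin H) s, IsGreatest (Set.range fun a => Q h s a) (V h.castSucc s)

/-- `alg` chooses the policy of each episode from the data of the previous ones exactly as RSVI
does (with `K` episodes, bonus constant `c`, confidence `δ` and risk parameter `β`): the policy is
greedy for the estimates `Q_h`. Ties in the arg max may be broken in any way. -/
def IsRSVI [Fintype S] [Fintype A] (M : EpisodicMDP S A H) (K : ℕ) (c δ β : ℝ)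
    (alg : (n : ℕ) → (Fin n → Episode S A H) → Policy S A H) : Prop :=
  ∀ (n : ℕ) (D : Fin n → Episode S A H), ∃ w Q V, IsRSVIEstimate M K c δ β D w Q V ∧
    ∀ h s a, Q h s a ≤ Q h s (alg n D h s)

/-- The joint law of the first `K` episodes when the agent plays `alg` and the environment chooses
the initial state of each episode by `env`, possibly at random and depending on the past. -/
def runLaw (M : EpisodicMDP S A H) (alg : (n : ℕ) → (Fin n → Episode S A H) → Policy S A H)
    (env : (n : ℕ) → (Fin n → Episode S A H) → PMF S) : (K : ℕ) → PMF (Fin K → Episode S A H)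
  | 0 => PMF.pure fun i => i.elim0
  | K + 1 => (runLaw M alg env K).bind fun D => (env K D).bind fun s =>
      (M.episodeLaw (alg K D) s).map fun x =>
        (Fin.snoc D ⟨alg K D, x⟩ : Fin (K + 1) → Episode S A H)

/-- `Regret(K) = ∑_k [V₁^*(s₁^k) - V₁^{π^k}(s₁^k)]`. -/
def regret [Fintype S] (M : EpisodicMDP S A H) (β : ℝ) {K : ℕ} (D : Fin K → Episode S A H) : ℝ :=
  ∑ k : Fin K, (M.optValue β ((D k).state 0) - M.value β (D k).policy ((D k).state 0))

end MDP

/-- `λ(u) = (e^{3u} - 1) / u`, for `u > 0`. -/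
def lam (u : ℝ) : ℝ := (Real.exp (3 * u) - 1) / u

end RiskRL

end

/-! Everything is measured in the scale φ(v) = (e^{βv} - 1)/β (`expUtil`), which is increasing for
either sign of β. In this scale the risk-sensitive Bellman equation is affine in the value of the
next step (`utilValue_succ`), and the estimates of RSVI become "empirical Bellman update plus bonus,
capped" for both signs (`IsRSVIEstimate.expUtil_Q`). When |β|H ≤ 1, φ distorts differences on [0, H]
and amplifies errors over H steps only by universal constants, so the risk-neutral optimistic
argument goes through.

The estimate of the next value depends on the same data as the empirical averages. Transition
frequencies are therefore controlled for all sets B of states at once (`Accurate`). Since a [0,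
R]-valued function is worst when it is R times an indicator, this gives concentration uniformly over
all such functions (`sum_hit_mul_sub_le`). The union over 2^S sets is paid for by the factor S under
the root of the bonus.

On the accurate event the estimates are optimistic (`IsRSVIEstimate.bellman_le_Q`) and exceed the
Bellman update by at most twice the bonus. Hence the regret of an episode is at most 55H times the
expected sum of uncertainties along its path (`IsRSVIEstimate.optValue_sub_value_le`). Expected
uncertainties are exchanged for realized ones by a multiplicative supermartingale bound
(`toOuterMeasure_mean_le`), which costs a factor 2 and an additive 2 log(2/δ). A pigeonhole argument
bounds the realized sum at each step by a multiple of √(S · log term · SAK) (`sum_uncertainty_le`).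
Summed over the H steps and multiplied by H, this is of order H²√(S²AK) up to the logarithm, that
is, √(H³S²AT). -/

namespace RiskRL

/-! ### Real expectations under a PMF on a finite type -/

section Expectation

variable {α γ : Type*} [Fintype α] [Fintype γ]

/-- Expectation of a real function on a finite type. -/
noncomputable def expect (p : PMF α) (f : α → ℝ) : ℝ := ∑ x, (p x).toReal * f x

theorem sum_toReal (p : PMF α) : ∑ x, (p x).toReal = 1 := by
  rw [← ENNReal.toReal_sum fun x _ => p.apply_ne_top x, ← tsum_fintype (L := .unconditional _),
    p.tsum_coe, ENNReal.toReal_one]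

theorem expect_const (p : PMF α) (c : ℝ) : expect p (fun _ => c) = c := by
  rw [expect, ← Finset.sum_mul, sum_toReal, one_mul]

theorem expect_mono {p : PMF α} {f g : α → ℝ} (h : ∀ x, f x ≤ g x) : expect p f ≤ expect p g :=
  Finset.sum_le_sum fun x _ => mul_le_mul_of_nonneg_left (h x) ENNReal.toReal_nonneg

theorem expect_nonneg {p : PMF α} {f : α → ℝ} (h : ∀ x, 0 ≤ f x) : 0 ≤ expect p f :=
  Finset.sum_nonneg fun x _ => mul_nonneg ENNReal.toReal_nonneg (h x)

theorem expect_add (p : PMF α) (f g : α → ℝ) :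
    expect p (fun x => f x + g x) = expect p f + expect p g := by
  simp only [expect, mul_add, Finset.sum_add_distrib]

theorem expect_sub (p : PMF α) (f g : α → ℝ) :
    expect p (fun x => f x - g x) = expect p f - expect p g := by
  simp only [expect, mul_sub, Finset.sum_sub_distrib]

theorem expect_const_mul (p : PMF α) (c : ℝ) (f : α → ℝ) :
    expect p (fun x => c * f x) = c * expect p f := by
  simp only [expect, Finset.mul_sum]
  exact Finset.sum_congr rfl fun x _ => by ring

theorem expect_pure (a : α) (f : α → ℝ) : expect (PMF.pure a) f = f a := by
  classical
  rw [expect, Finset.sum_eq_single a]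
  · simp
  · intro b _ hb; simp [hb]
  · simp

theorem expect_bind (p : PMF α) (q : α → PMF γ) (f : γ → ℝ) :
    expect (p.bind q) f = expect p fun a => expect (q a) f := by
  have h : ∀ x, ((p.bind q) x).toReal = ∑ a, (p a).toReal * (q a x).toReal := fun x => by
    rw [PMF.bind_apply, tsum_fintype, ENNReal.toReal_sum fun a _ =>
      ENNReal.mul_ne_top (p.apply_ne_top a) ((q a).apply_ne_top x)]
    simp only [ENNReal.toReal_mul]
  simp only [expect, h, Finset.sum_mul, Finset.mul_sum]
  rw [Finset.sum_comm]
  exact Finset.sum_congr rfl fun a _ => Finset.sum_congr rfl fun x _ => by ring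

theorem expect_map (p : PMF α) (g : α → γ) (f : γ → ℝ) :
    expect (p.map g) f = expect p (f ∘ g) := by
  rw [← PMF.bind_pure_comp, expect_bind]
  simp [expect_pure, Function.comp_def]

theorem tsum_mul_ofReal (p : PMF α) {f : α → ℝ} (hf : ∀ x, 0 ≤ f x) :
    ∑' x, p x * ENNReal.ofReal (f x) = ENNReal.ofReal (expect p f) := by
  rw [tsum_fintype, expect,
    ENNReal.ofReal_sum_of_nonneg fun x _ => mul_nonneg ENNReal.toReal_nonneg (hf x)]
  refine Finset.sum_congr rfl fun x _ => ?_
  rw [ENNReal.ofReal_mul ENNReal.toReal_nonneg, ENNReal.ofReal_toReal (p.apply_ne_top x)]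

end Expectation

/-! ### Extended nonnegative expectations and Markov's inequality -/

section ENNRealExpectation

variable {α γ : Type*}

theorem tsum_bind_mul (p : PMF α) (q : α → PMF γ) (f : γ → ENNReal) :
    ∑' x, (p.bind q) x * f x = ∑' a, p a * ∑' x, q a x * f x := by
  simp only [PMF.bind_apply, ← ENNReal.tsum_mul_right, ← ENNReal.tsum_mul_left, mul_assoc]
  rw [ENNReal.tsum_comm]

theorem tsum_map_mul (p : PMF α) (g : α → γ) (f : γ → ENNReal) :
    ∑' x, (p.map g) x * f x = ∑' a, p a * f (g a) := by
  rw [← PMF.bind_pure_comp, tsum_bind_mul]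
  simp

theorem tsum_mul_le_of_le (p : PMF α) {f : α → ENNReal} {c : ENNReal} (h : ∀ a, f a ≤ c) :
    ∑' a, p a * f a ≤ c := by
  calc ∑' a, p a * f a ≤ ∑' a, p a * c := ENNReal.tsum_le_tsum fun a => by gcongr; exact h a
    _ = c := by rw [ENNReal.tsum_mul_right, p.tsum_coe, one_mul]

theorem tsum_mul_congr {p : PMF α} {f g : α → ENNReal} (h : ∀ x, p x ≠ 0 → f x = g x) :
    ∑' x, p x * f x = ∑' x, p x * g x := by
  refine tsum_congr fun x => ?_
  by_cases hx : p x = 0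
  · simp [hx]
  · rw [h x hx]

/-- Markov's inequality. -/
theorem toOuterMeasure_le_of_tsum_le_one (p : PMF α) {f : α → ENNReal} (hf : ∑' x, p x * f x ≤ 1)
    {s : Set α} {t : ENNReal} (ht : ∀ x ∈ s, t⁻¹ ≤ f x) (h0 : t ≠ 0) (h1 : t ≠ ⊤) :
    p.toOuterMeasure s ≤ t := by
  have h : p.toOuterMeasure s * t⁻¹ ≤ 1 := by
    rw [PMF.toOuterMeasure_apply, ← ENNReal.tsum_mul_right]
    refine (ENNReal.tsum_le_tsum fun x => ?_).trans hf
    by_cases hx : x ∈ s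
    · rw [Set.indicator_of_mem hx]; gcongr; exact ht x hx
    · simp [hx]
  calc p.toOuterMeasure s = p.toOuterMeasure s * t⁻¹ * t := by
        rw [mul_assoc, ENNReal.inv_mul_cancel h0 h1, mul_one]
    _ ≤ 1 * t := by gcongr
    _ = t := one_mul t

end ENNRealExpectation

/-! ### Markov paths and the Bellman recursion in the transformed scale -/

section Path

variable {S : Type*}

theorem pathLaw_start : ∀ {H : ℕ} {κ : Fin H → S → PMF S} {s : S} {x : Fin (H + 1) → S},
    pathLaw H κ s x ≠ 0 → x 0 = s
  | 0, κ, s, x, hx => by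
    rw [pathLaw] at hx
    have := (PMF.mem_support_iff _ _).2 hx
    rw [PMF.support_pure, Set.mem_singleton_iff] at this
    rw [this]
  | H + 1, κ, s, x, hx => by
    rw [pathLaw] at hx
    have := (PMF.mem_support_iff _ _).2 hx
    rw [PMF.mem_support_bind_iff] at this
    obtain ⟨s', -, h⟩ := this
    rw [PMF.mem_support_map_iff] at h
    obtain ⟨y, -, rfl⟩ := h
    rfl

/-- The one-step conditional law along a path. -/
theorem tsum_pathLaw_step_le : ∀ {H : ℕ} (κ : Fin H → S → PMF S) (s : S) (h : Fin H)
    (f : S → S → ENNReal), (∀ s, ∑' s', κ h s s' * f s s' ≤ 1) →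
    ∑' x, pathLaw H κ s x * f (x h.castSucc) (x h.succ) ≤ 1
  | 0, _, _, h, _, _ => h.elim0
  | H + 1, κ, s, h, f, hf => by
    rw [pathLaw, tsum_bind_mul]
    simp only [tsum_map_mul]
    cases h using Fin.cases with
    | zero =>
      refine le_trans (le_of_eq ?_) (hf s)
      refine tsum_congr fun s' => ?_
      congr 1
      simp only [Fin.castSucc_zero, Fin.cons_zero, Fin.cons_succ]
      rw [tsum_mul_congr (g := fun _ => f s s') fun x hx => by rw [pathLaw_start hx],
        ENNReal.tsum_mul_right, PMF.tsum_coe, one_mul]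
    | succ h =>
      refine tsum_mul_le_of_le _ fun s' => ?_
      simp only [Fin.castSucc_succ, Fin.cons_succ]
      exact tsum_pathLaw_step_le (fun h => κ h.succ) s' h f hf

variable [Fintype S]

theorem expect_pathLaw_succ {H : ℕ} (κ : Fin (H + 1) → S → PMF S) (s : S)
    (f : (Fin (H + 2) → S) → ℝ) :
    expect (pathLaw (H + 1) κ s) f =
      expect (κ 0 s) fun s' => expect (pathLaw H (fun h => κ h.succ) s') fun x =>
        f (Fin.cons s x) := by
  rw [pathLaw, expect_bind]
  simp only [expect_map, Function.comp_def]

/-- The value transform `v ↦ (e^{βv} - 1) / β`, increasing in `v` for either sign of `β`. -/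
noncomputable def expUtil (β v : ℝ) : ℝ := (Real.exp (β * v) - 1) / β

/-- The transform of the risk-sensitive value of a Markov chain with rewards `ρ`. -/
noncomputable def utilValue (β : ℝ) {H : ℕ} (κ : Fin H → S → PMF S) (ρ : Fin H → S → ℝ)
    (s : S) : ℝ :=
  (expect (pathLaw H κ s) (fun x => Real.exp (β * ∑ h, ρ h (x h.castSucc))) - 1) / β

theorem utilValue_zero (β : ℝ) (κ : Fin 0 → S → PMF S) (ρ : Fin 0 → S → ℝ) (s : S) :
    utilValue β κ ρ s = 0 := by
  simp [utilValue, expect_const]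

/-- The Bellman equation in the transformed scale. -/
theorem utilValue_succ {β : ℝ} (hβ : β ≠ 0) {H : ℕ} (κ : Fin (H + 1) → S → PMF S)
    (ρ : Fin (H + 1) → S → ℝ) (s : S) :
    utilValue β κ ρ s = expUtil β (ρ 0 s) + Real.exp (β * ρ 0 s) *
      expect (κ 0 s) (utilValue β (fun h => κ h.succ) fun h => ρ h.succ) := by
  set U : S → ℝ := fun s' => expect (pathLaw H (fun h => κ h.succ) s')
    (fun x => Real.exp (β * ∑ h : Fin H, ρ h.succ (x h.castSucc))) with hU
  have h1 : expect (pathLaw (H + 1) κ s) (fun x => Real.exp (β * ∑ h, ρ h (x h.castSucc))) =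
      Real.exp (β * ρ 0 s) * expect (κ 0 s) U := by
    rw [expect_pathLaw_succ, ← expect_const_mul]
    congr 1; funext s'
    rw [hU, ← expect_const_mul]
    congr 1; funext x
    rw [Fin.sum_univ_succ, mul_add, Real.exp_add]
    simp
  have h2 : expect (κ 0 s) (utilValue β (fun h => κ h.succ) fun h => ρ h.succ) =
      (expect (κ 0 s) U - 1) / β := by
    have : (utilValue β (fun h => κ h.succ) fun h => ρ h.succ) = fun s' => β⁻¹ * (U s' - 1) := by
      funext s'; rw [utilValue, div_eq_inv_mul]
    rw [this, expect_const_mul, expect_sub, expect_const, div_eq_inv_mul]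
  rw [utilValue, h1, h2, expUtil]
  field_simp
  ring

/-- Comparison principle: the recursion is monotone because the factor e^{βρ} is positive, so a
supersolution dominates the value. This yields optimism. -/
theorem utilValue_le {β : ℝ} (hβ : β ≠ 0) : ∀ {H : ℕ} (κ : Fin H → S → PMF S)
    (ρ : Fin H → S → ℝ) (Y : Fin (H + 1) → S → ℝ), (∀ s, 0 ≤ Y (Fin.last H) s) →
    (∀ (h : Fin H) s, expUtil β (ρ h s) + Real.exp (β * ρ h s) * expect (κ h s) (Y h.succ) ≤
      Y h.castSucc s) → ∀ s, utilValue β κ ρ s ≤ Y 0 s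
  | 0, κ, ρ, Y, h0, _, s => by rw [utilValue_zero]; exact h0 s
  | H + 1, κ, ρ, Y, h0, h1, s => by
    rw [utilValue_succ hβ]
    refine le_trans ?_ (h1 0 s)
    gcongr
    exact expect_mono fun s' => utilValue_le hβ (fun h => κ h.succ) (fun h => ρ h.succ)
      (fun h => Y h.succ) h0 (fun h s => h1 h.succ s) s'

/-- The converse comparison, for a subsolution with defect `c`. Passing through one step multiplies
the accumulated error by e^{βρ} ≤ e^{|β|}, whence the factor e^{|β|H}. -/
theorem sub_utilValue_le {β : ℝ} (hβ : β ≠ 0) : ∀ {H : ℕ} (κ : Fin H → S → PMF S)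
    (ρ : Fin H → S → ℝ) (Y : Fin (H + 1) → S → ℝ) (c : Fin H → S → ℝ),
    (∀ h s, |ρ h s| ≤ 1) → (∀ h s, 0 ≤ c h s) →
    (∀ s, Y (Fin.last H) s ≤ 0) →
    (∀ (h : Fin H) s, Y h.castSucc s ≤
      expUtil β (ρ h s) + Real.exp (β * ρ h s) * expect (κ h s) (Y h.succ) + c h s) →
    ∀ s, Y 0 s - utilValue β κ ρ s ≤
      Real.exp (|β| * H) * expect (pathLaw H κ s) fun x => ∑ h, c h (x h.castSucc)
  | 0, κ, ρ, Y, c, _, _, h0, _, s => by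
    rw [utilValue_zero]; simpa [expect_const] using h0 s
  | H + 1, κ, ρ, Y, c, hρ, hc, h0, h1, s => by
    have ih := sub_utilValue_le hβ (fun h => κ h.succ) (fun h => ρ h.succ)
      (fun h => Y h.succ) (fun h => c h.succ) (fun h => hρ h.succ) (fun h => hc h.succ) h0
      (fun h s => h1 h.succ s)
    set G : S → ℝ := fun s' => expect (pathLaw H (fun h => κ h.succ) s')
      fun x => ∑ h : Fin H, c h.succ (x h.castSucc) with hG
    have hsum : expect (pathLaw (H + 1) κ s) (fun x => ∑ h, c h (x h.castSucc)) =
        c 0 s + expect (κ 0 s) G := by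
      rw [expect_pathLaw_succ]
      simp only [Fin.sum_univ_succ, Fin.castSucc_zero, Fin.cons_zero, Fin.castSucc_succ,
        Fin.cons_succ, expect_add, expect_const, hG]
    have hG0 : 0 ≤ expect (κ 0 s) G := expect_nonneg fun s' => expect_nonneg fun x =>
      Finset.sum_nonneg fun h _ => hc _ _
    have h2 : expect (κ 0 s) (Y (Fin.succ 0)) -
        expect (κ 0 s) (utilValue β (fun h => κ h.succ) fun h => ρ h.succ) ≤
        Real.exp (|β| * H) * expect (κ 0 s) G := by
      rw [← expect_sub, ← expect_const_mul]
      exact expect_mono ih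
    have he : Real.exp (β * ρ 0 s) ≤ Real.exp |β| := by
      gcongr
      calc β * ρ 0 s ≤ |β * ρ 0 s| := le_abs_self _
        _ = |β| * |ρ 0 s| := abs_mul _ _
        _ ≤ |β| * 1 := by gcongr; exact hρ 0 s
        _ = |β| := mul_one _
    have h3 := h1 0 s
    rw [hsum, utilValue_succ hβ]
    have h4 : Real.exp (β * ρ 0 s) * (expect (κ 0 s) (Y (Fin.succ 0)) -
        expect (κ 0 s) (utilValue β (fun h => κ h.succ) fun h => ρ h.succ)) ≤
        Real.exp |β| * (Real.exp (|β| * H) * expect (κ 0 s) G) := by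
      calc _ ≤ Real.exp (β * ρ 0 s) * (Real.exp (|β| * H) * expect (κ 0 s) G) := by gcongr
        _ ≤ _ := by gcongr
    have h5 : Real.exp (|β| * ((H + 1 : ℕ) : ℝ)) = Real.exp |β| * Real.exp (|β| * H) := by
      rw [← Real.exp_add]; push_cast; ring_nf
    have h6 : 1 ≤ Real.exp (|β| * ((H + 1 : ℕ) : ℝ)) := Real.one_le_exp (by positivity)
    have h7 : c 0 s ≤ Real.exp (|β| * ((H + 1 : ℕ) : ℝ)) * c 0 s :=
      le_mul_of_one_le_left (hc 0 s) h6
    rw [mul_add, h5, mul_assoc (Real.exp |β|)]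
    rw [h5] at h7
    rw [Fin.castSucc_zero] at h3
    linarith

end Path


/-! ### The interaction of agent and environment as a supermartingale -/

section Run

variable {S A : Type*} {H : ℕ}

/-- The episodes before episode `k`. -/
def history {α : Type*} {K : ℕ} (D : Fin K → α) (k : Fin K) : Fin k → α :=
  fun i => D (Fin.castLE k.isLt.le i)

theorem history_snoc_castSucc {α : Type*} {K : ℕ} (D : Fin K → α) (e : α) (k : Fin K) :
    history (Fin.snoc D e : Fin (K + 1) → α) k.castSucc = history D k := by
  funext i
  exact Fin.snoc_castSucc (α := fun _ => α) e D (Fin.castLE k.isLt.le i)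

theorem history_snoc_last {α : Type*} {K : ℕ} (D : Fin K → α) (e : α) :
    history (Fin.snoc D e : Fin (K + 1) → α) (Fin.last K) = D := by
  funext i
  exact Fin.snoc_castSucc (α := fun _ => α) e D i

theorem prod_history {α β : Type*} [CommMonoid β] {K : ℕ} (D : Fin K → α) (k : Fin K) (f : α → β) :
    ∏ τ : Fin K, (if (τ : ℕ) < k then f (D τ) else 1) = ∏ i, f (history D k i) := by
  rw [← Finset.prod_filter]
  have : Finset.univ.filter (fun τ : Fin K => (τ : ℕ) < k) =
      Finset.univ.map (Fin.castLEEmb k.isLt.le) := by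
    ext τ
    simp only [Finset.mem_filter, Finset.mem_univ, true_and, Finset.mem_map, Fin.castLEEmb_apply]
    exact ⟨fun h => ⟨⟨τ, h⟩, rfl⟩, by rintro ⟨i, rfl⟩; exact i.isLt⟩
  rw [this, Finset.prod_map]
  rfl

variable {M : EpisodicMDP S A H} {alg : (n : ℕ) → (Fin n → Episode S A H) → Policy S A H}
  {env : (n : ℕ) → (Fin n → Episode S A H) → PMF S}

/-- The product is a supermartingale: given the past and the initial state, each new factor has mean
at most 1, whatever the environment does. Every concentration bound below is Markov's inequality for
such a product. -/
theorem tsum_runLaw_prod_le {g : (n : ℕ) → (Fin n → Episode S A H) → Episode S A H → ENNReal}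
    (hg : ∀ n D s, ∑' x, M.episodeLaw (alg n D) s x * g n D ⟨alg n D, x⟩ ≤ 1) (K : ℕ) :
    ∑' D, runLaw M alg env K D * ∏ k : Fin K, g k (history D k) (D k) ≤ 1 := by
  induction K with
  | zero => simpa using PMF.coe_le_one _ _
  | succ K ih =>
    rw [runLaw, tsum_bind_mul]
    refine le_trans (ENNReal.tsum_le_tsum fun D => ?_) ih
    gcongr
    rw [tsum_bind_mul]
    refine tsum_mul_le_of_le _ fun s => ?_
    rw [tsum_map_mul]
    simp only [Fin.prod_univ_castSucc, history_snoc_castSucc, history_snoc_last,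
      Fin.snoc_castSucc, Fin.snoc_last, Fin.val_castSucc, Fin.val_last]
    calc _ = (∏ k : Fin K, g k (history D k) (D k)) *
          ∑' x, M.episodeLaw (alg K D) s x * g K D ⟨alg K D, x⟩ := by
          rw [← ENNReal.tsum_mul_left]
          exact tsum_congr fun x => by ring
      _ ≤ (∏ k : Fin K, g k (history D k) (D k)) * 1 := by gcongr; exact hg K D s
      _ = _ := mul_one _

theorem policy_of_runLaw_ne_zero {K : ℕ} {D : Fin K → Episode S A H}
    (hD : runLaw M alg env K D ≠ 0) (k : Fin K) : (D k).policy = alg k (history D k) := by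
  induction K with
  | zero => exact k.elim0
  | succ K ih =>
    rw [runLaw] at hD
    have := (PMF.mem_support_iff _ _).2 hD
    simp only [PMF.mem_support_bind_iff, PMF.mem_support_map_iff] at this
    obtain ⟨D, hD', s, -, x, -, rfl⟩ := this
    induction k using Fin.lastCases with
    | last => rw [history_snoc_last, Fin.snoc_last]; rfl
    | cast k =>
      rw [history_snoc_castSucc, Fin.snoc_castSucc]
      exact ih ((PMF.mem_support_iff _ _).1 hD') k

end Run


/-! ### Concentration of transition frequencies and of path functionals -/

section Concentration

/-- From e^y ≤ 1 + y + y² for |y| ≤ 1; the linear term has mean zero. -/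
theorem expect_exp_centered_le {α : Type*} [Fintype α] (p : PMF α) {f : α → ℝ}
    (h0 : ∀ x, 0 ≤ f x) (h1 : ∀ x, f x ≤ 1) {l : ℝ} (hl0 : 0 ≤ l) (hl1 : l ≤ 1) :
    expect p (fun x => Real.exp (l * (f x - expect p f))) ≤ Real.exp (l ^ 2) := by
  set m := expect p f with hm
  have hm0 : 0 ≤ m := expect_nonneg h0
  have hm1 : m ≤ 1 := (expect_mono h1).trans_eq (expect_const p 1)
  have hx : ∀ x, Real.exp (l * (f x - m)) ≤ (1 + l ^ 2) + l * (f x - m) := fun x => by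
    have habs : |f x - m| ≤ 1 := by
      rw [abs_le]; constructor <;> linarith [h0 x, h1 x]
    have hy : |l * (f x - m)| ≤ l := by
      rw [abs_mul, abs_of_nonneg hl0]; exact mul_le_of_le_one_right hl0 habs
    have h2 := Real.abs_exp_sub_one_sub_id_le (hy.trans hl1)
    have h3 : (l * (f x - m)) ^ 2 ≤ l ^ 2 := by
      rw [← sq_abs]; gcongr
    linarith [(abs_le.1 h2).2]
  calc _ ≤ expect p (fun x => (1 + l ^ 2) + l * (f x - m)) := expect_mono hx
    _ = 1 + l ^ 2 := by
      rw [expect_add, expect_const, expect_const_mul, expect_sub, expect_const, ← hm]; ring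
    _ ≤ _ := by linarith [Real.add_one_le_exp (l ^ 2)]

/-- A one-sided multiplicative bound: half the mean dominates the exponential moment. -/
theorem expect_exp_half_mean_sub_le {α : Type*} [Fintype α] (p : PMF α) {f : α → ℝ}
    (h0 : ∀ x, 0 ≤ f x) (h1 : ∀ x, f x ≤ 1) :
    expect p (fun x => Real.exp (expect p f / 2 - f x)) ≤ 1 := by
  set m := expect p f with hm
  have hx : ∀ x, Real.exp (m / 2 - f x) ≤ Real.exp (m / 2) * (1 - 1 / 2 * f x) := fun x => by
    rw [sub_eq_add_neg, Real.exp_add]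
    gcongr
    have h2 := Real.abs_exp_sub_one_sub_id_le (x := - f x)
      (by rw [abs_neg, abs_of_nonneg (h0 x)]; exact h1 x)
    -- On [0, 1] the convex function e^{-y} lies below its chord 1 - (1 - e^{-1})y, which is at most
    -- 1 - y/2.
    have h3 := convexOn_exp.2 (Set.mem_univ (0 : ℝ)) (Set.mem_univ (-1 : ℝ))
      (sub_nonneg.2 (h1 x)) (h0 x) (by ring)
    simp only [smul_eq_mul, mul_zero, zero_add, mul_neg, mul_one, Real.exp_zero] at h3
    have h4 : Real.exp (-1) ≤ 1 / 2 := by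
      rw [Real.exp_neg, one_div]
      gcongr
      linarith [Real.add_one_le_exp (1 : ℝ)]
    nlinarith [h0 x]
  calc _ ≤ expect p (fun x => Real.exp (m / 2) * (1 - 1 / 2 * f x)) := expect_mono hx
    _ = Real.exp (m / 2) * (1 - m / 2) := by
      rw [expect_const_mul, expect_sub, expect_const, expect_const_mul, ← hm]; ring
    _ ≤ Real.exp (m / 2) * Real.exp (-(m / 2)) := by
      gcongr; linarith [Real.add_one_le_exp (-(m / 2))]
    _ = 1 := by rw [← Real.exp_add]; simp

variable {S A : Type*} {H : ℕ}

open Classical in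
/-- Whether an episode visits `(s, a)` at step `h`. -/
noncomputable def hit (h : Fin H) (s : S) (a : A) (e : Episode S A H) : ℝ :=
  if e.at h = s ∧ e.action h = a then 1 else 0

theorem sum_hit {n : ℕ} (D : Fin n → Episode S A H) (h : Fin H) (s : S) (a : A) :
    ∑ τ, hit h s a (D τ) = visits D h s a := by
  simp [hit, visits]

theorem visits_le {n : ℕ} (D : Fin n → Episode S A H) (h : Fin H) (s : S) (a : A) :
    visits D h s a ≤ n := by
  classical
  unfold visits
  exact (Finset.card_filter_le _ _).trans_eq (by simp)

open Classical in
/-- The indicator function of a finite set. -/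
noncomputable def ind (B : Finset S) (s : S) : ℝ := if s ∈ B then 1 else 0

theorem ind_nonneg (B : Finset S) (s : S) : 0 ≤ ind B s := by
  unfold ind; split_ifs <;> norm_num

theorem ind_le_one (B : Finset S) (s : S) : ind B s ≤ 1 := by
  unfold ind; split_ifs <;> norm_num

variable [Fintype S]

open Classical in
/-- The contribution of an episode to the deviation of the empirical frequency of transitions
from `(s, a)` into `B`. -/
noncomputable def deviation (M : EpisodicMDP S A H) (h : Fin H) (s : S) (a : A) (B : Finset S)
    (e : Episode S A H) : ℝ :=
  if e.at h = s ∧ e.action h = a then ind B (e.next h) - expect (M.P h s a) (ind B) else 0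

theorem deviation_le_hit (M : EpisodicMDP S A H) (h : Fin H) (s : S) (a : A) (B : Finset S)
    (e : Episode S A H) : deviation M h s a B e ≤ hit h s a e := by
  unfold deviation hit
  split_ifs
  · linarith [ind_le_one B (e.next h), expect_nonneg (p := M.P h s a) (ind_nonneg B)]
  · exact le_rfl

/-- The compensator l² is charged only on a visit to the pair, so the total compensation over a
history is l² times the visit count. -/
theorem tsum_exp_deviation_le (M : EpisodicMDP S A H) (h : Fin H) (s : S) (a : A) (B : Finset S)
    {l : ℝ} (hl0 : 0 ≤ l) (hl1 : l ≤ 1) (π : Policy S A H) (s₁ : S) :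
    ∑' x, M.episodeLaw π s₁ x * ENNReal.ofReal
      (Real.exp (l * deviation M h s a B ⟨π, x⟩ - l ^ 2 * hit h s a ⟨π, x⟩)) ≤ 1 := by
  classical
  refine tsum_pathLaw_step_le (fun h x => M.P h x (π h x)) s₁ h (fun u v => ENNReal.ofReal
    (Real.exp (l * (if u = s ∧ π h u = a then ind B v - expect (M.P h s a) (ind B) else 0) -
      l ^ 2 * (if u = s ∧ π h u = a then 1 else 0)))) fun u => ?_
  rw [tsum_mul_ofReal _ fun v => (Real.exp_pos _).le, ENNReal.ofReal_le_one]
  by_cases hu : u = s ∧ π h u = a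
  · obtain ⟨rfl, rfl⟩ := hu
    simp only [and_self, if_true, mul_one, sub_eq_add_neg _ (l ^ 2), Real.exp_add]
    simp only [mul_comm _ (Real.exp (-l ^ 2)), expect_const_mul]
    calc _ ≤ Real.exp (-l ^ 2) * Real.exp (l ^ 2) := by
          gcongr
          exact expect_exp_centered_le _ (ind_nonneg B) (ind_le_one B) hl0 hl1
      _ = 1 := by rw [← Real.exp_add]; simp
  · simp [hu, expect_const]

/-- The empirical transition frequencies of the data `D` are accurate. -/
def Accurate (M : EpisodicMDP S A H) (L : ℝ) {n : ℕ} (D : Fin n → Episode S A H) : Prop :=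
  ∀ h s a B, ∑ τ, deviation M h s a B (D τ) ≤ 2 * √(visits D h s a * L)

variable {M : EpisodicMDP S A H} {alg : (n : ℕ) → (Fin n → Episode S A H) → Policy S A H}
  {env : (n : ℕ) → (Fin n → Episode S A H) → PMF S}

/-- A Chernoff bound. Fixing the random visit count to `n` within the event allows the exponent `l`
to be a deterministic function of `n`. -/
theorem toOuterMeasure_deviation_le {K : ℕ} (k : Fin K) (h : Fin H) (s : S) (a : A) (B : Finset S)
    (n : ℕ) {L : ℝ} (hL : 0 < L) :
    (runLaw M alg env K).toOuterMeasure {D | visits (history D k) h s a = n ∧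
      2 * √(n * L) < ∑ τ, deviation M h s a B (history D k τ)} ≤ ENNReal.ofReal (Real.exp (-L)) := by
  by_cases hn : (n : ℝ) < L
  -- With fewer than L visits the optimal `l` would exceed 1, but then the event is empty: the
  -- deviation is at most n ≤ √(nL).
  · convert zero_le (a := ENNReal.ofReal (Real.exp (-L)))
    convert MeasureTheory.measure_empty (μ := (runLaw M alg env K).toOuterMeasure)
    rw [Set.eq_empty_iff_forall_notMem]
    rintro D ⟨h1, h2⟩
    refine absurd h2 (not_lt.2 ?_)
    calc _ ≤ ∑ τ, hit h s a (history D k τ) := Finset.sum_le_sum fun τ _ => deviation_le_hit ..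
      _ = n := by rw [sum_hit, h1]
      _ ≤ √(n * L) := Real.le_sqrt_of_sq_le (by rw [sq]; gcongr)
      _ ≤ _ := by linarith [Real.sqrt_nonneg (n * L)]
  rw [not_lt] at hn
  have hn0 : (0 : ℝ) < n := hL.trans_le hn
  -- The maximizer of 2l√(nL) - l²n, with maximum L.
  set l := √(L / n) with hl
  have hl0 : 0 ≤ l := Real.sqrt_nonneg _
  have hl1 : l ≤ 1 := by rw [hl, Real.sqrt_le_one]; exact (div_le_one hn0).2 hn
  have hl2 : l ^ 2 * n = L := by rw [hl, Real.sq_sqrt (by positivity)]; field_simp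
  have hl3 : l * √(n * L) = L := by
    rw [hl, ← Real.sqrt_mul (by positivity), show L / n * (n * L) = L ^ 2 by field_simp,
      Real.sqrt_sq hL.le]
  set f : Episode S A H → ENNReal := fun e => ENNReal.ofReal
    (Real.exp (l * deviation M h s a B e - l ^ 2 * hit h s a e)) with hf
  -- Factors from episode `k` on are replaced by 1, so that the product over all K episodes depends
  -- only on the history before `k`.
  have key := tsum_runLaw_prod_le (M := M) (alg := alg) (env := env)
    (g := fun n _ e => if n < k then f e else 1) (fun n D s₁ => by
      by_cases hnk : n < k
      · simp only [hnk, if_true, hf]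
        exact tsum_exp_deviation_le M h s a B hl0 hl1 _ s₁
      · simp only [hnk, if_false, mul_one, PMF.tsum_coe, le_refl]) K
  simp only [prod_history] at key
  refine toOuterMeasure_le_of_tsum_le_one _ key (fun D hD => ?_)
    (by simpa using Real.exp_pos _) ENNReal.ofReal_ne_top
  rw [hf, ← ENNReal.ofReal_prod_of_nonneg fun _ _ => (Real.exp_pos _).le, ← Real.exp_sum,
    Finset.sum_sub_distrib, ← Finset.mul_sum, ← Finset.mul_sum, sum_hit, hD.1,
    ← ENNReal.ofReal_inv_of_pos (Real.exp_pos _), ← Real.exp_neg, neg_neg, hl2]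
  gcongr
  nlinarith [mul_le_mul_of_nonneg_left hD.2.le hl0]

/-- Union bound over the episode, the step, the pair, the set B and the visit count; the count is at
most k < K, which gives the second factor K. -/
theorem toOuterMeasure_not_accurate_le [Fintype A] {L : ℝ} (hL : 0 < L) (K : ℕ) :
    (runLaw M alg env K).toOuterMeasure {D | ¬ ∀ k, Accurate M L (history D k)} ≤
      ENNReal.ofReal ((K : ℝ) ^ 2 * H * Fintype.card S * Fintype.card A * 2 ^ Fintype.card S *
        Real.exp (-L)) := by
  have hsub : {D : Fin K → Episode S A H | ¬ ∀ k, Accurate M L (history D k)} ⊆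
      ⋃ i ∈ (Finset.univ : Finset (Fin K × Fin H × S × A × Finset S × Fin K)),
        {D | visits (history D i.1) i.2.1 i.2.2.1 i.2.2.2.1 = (i.2.2.2.2.2 : ℕ) ∧
          2 * √((i.2.2.2.2.2 : ℕ) * L) <
            ∑ τ, deviation M i.2.1 i.2.2.1 i.2.2.2.1 i.2.2.2.2.1 (history D i.1 τ)} := by
    intro D hD
    simp only [Set.mem_ofPred_eq, Accurate, not_forall, not_le] at hD
    obtain ⟨k, h, s, a, B, hlt⟩ := hD
    simp only [Set.mem_iUnion]
    exact ⟨(k, h, s, a, B, ⟨_, (visits_le (history D k) h s a).trans_lt k.isLt⟩),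
      Finset.mem_univ _, rfl, hlt⟩
  refine (MeasureTheory.measure_mono hsub).trans ((MeasureTheory.measure_biUnion_finset_le _ _).trans
    ((Finset.sum_le_sum fun i _ => toOuterMeasure_deviation_le i.1 i.2.1 i.2.2.1 i.2.2.2.1
      i.2.2.2.2.1 _ hL).trans_eq ?_))
  rw [Finset.sum_const, ← ENNReal.ofReal_nsmul, nsmul_eq_mul]
  congr 2
  simp only [Finset.card_univ, Fintype.card_prod, Fintype.card_fin, Fintype.card_finset]
  push_cast
  ring

/-- The conditional means of `[0, 1]`-valued path functionals are dominated by their values. -/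
theorem toOuterMeasure_mean_le (F : (n : ℕ) → (Fin n → Episode S A H) → (Fin (H + 1) → S) → ℝ)
    (h0 : ∀ n D x, 0 ≤ F n D x) (h1 : ∀ n D x, F n D x ≤ 1) (K : ℕ) (t : ℝ) :
    (runLaw M alg env K).toOuterMeasure {D | 2 * ∑ k : Fin K, F k (history D k) (D k).state + t <
      ∑ k : Fin K, expect (M.episodeLaw (alg k (history D k)) ((D k).state 0))
        (F k (history D k))} ≤ ENNReal.ofReal (Real.exp (-(t / 2))) := by
  have key := tsum_runLaw_prod_le (M := M) (alg := alg) (env := env)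
    (g := fun n D e => ENNReal.ofReal (Real.exp
      (expect (M.episodeLaw (alg n D) (e.state 0)) (F n D) / 2 - F n D e.state)))
    (fun n D s₁ => by
      calc _ = ∑' x, M.episodeLaw (alg n D) s₁ x * ENNReal.ofReal (Real.exp
            (expect (M.episodeLaw (alg n D) s₁) (F n D) / 2 - F n D x)) :=
            tsum_mul_congr fun x hx => by
              dsimp only
              rw [pathLaw_start hx]
        _ ≤ 1 := by
          rw [tsum_mul_ofReal _ fun v => (Real.exp_pos _).le, ENNReal.ofReal_le_one]
          exact expect_exp_half_mean_sub_le _ (h0 n D) (h1 n D)) K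
  refine toOuterMeasure_le_of_tsum_le_one _ key (fun D hD => ?_)
    (by simpa using Real.exp_pos _) ENNReal.ofReal_ne_top
  rw [← ENNReal.ofReal_prod_of_nonneg fun _ _ => (Real.exp_pos _).le, ← Real.exp_sum,
    ← ENNReal.ofReal_inv_of_pos (Real.exp_pos _), ← Real.exp_neg, neg_neg,
    Finset.sum_sub_distrib, ← Finset.sum_div]
  gcongr
  rw [Set.mem_ofPred_eq] at hD
  linarith

end Concentration


/-! ### The exponential utility scale -/

section ExpUtil

theorem expUtil_zero (β : ℝ) : expUtil β 0 = 0 := by simp [expUtil]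

theorem expUtil_strictMono {β : ℝ} (hβ : β ≠ 0) : StrictMono (expUtil β) := fun u v huv => by
  unfold expUtil
  rcases lt_or_gt_of_ne hβ with hb | hb
  · rw [div_lt_div_right_of_neg hb]
    have : Real.exp (β * v) < Real.exp (β * u) :=
      Real.exp_lt_exp.2 (mul_lt_mul_of_neg_left huv hb)
    linarith
  · gcongr

theorem expUtil_nonneg {β v : ℝ} (hβ : β ≠ 0) (hv : 0 ≤ v) : 0 ≤ expUtil β v :=
  (expUtil_zero β).symm.trans_le ((expUtil_strictMono hβ).monotone hv)

theorem expUtil_add {β : ℝ} (hβ : β ≠ 0) (u v : ℝ) :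
    expUtil β (u + v) = expUtil β u + Real.exp (β * u) * expUtil β v := by
  unfold expUtil
  rw [mul_add, Real.exp_add]
  field_simp
  ring

theorem exp_neg_abs_mul_le {β v b : ℝ} (hv : |v| ≤ b) : Real.exp (-(|β| * b)) ≤ Real.exp (β * v) := by
  gcongr
  have : |β * v| ≤ |β| * b := by rw [abs_mul]; gcongr
  exact (abs_le.1 this).1

theorem exp_mul_le {β v b : ℝ} (hv : |v| ≤ b) : Real.exp (β * v) ≤ Real.exp (|β| * b) := by
  refine Real.exp_le_exp.2 ?_
  have : |β * v| ≤ |β| * b := by rw [abs_mul]; gcongr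
  exact (abs_le.1 this).2

theorem le_expUtil {β v b : ℝ} (hβ : β ≠ 0) (h0 : 0 ≤ v) (hv : v ≤ b) :
    Real.exp (-(|β| * b)) * v ≤ expUtil β v := by
  unfold expUtil
  rcases lt_or_gt_of_ne hβ with hb | hb
  · rw [le_div_iff_of_neg hb]
    have h1 := exp_neg_abs_mul_le (β := β) ((abs_of_nonneg h0).trans_le hv)
    have h2 := Real.add_one_le_exp (-(β * v))
    have h3 : Real.exp (β * v) * Real.exp (-(β * v)) = 1 := by rw [← Real.exp_add]; simp
    have h4 := mul_le_mul_of_nonneg_left h2 (Real.exp_pos (β * v)).le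
    have h5 := mul_le_mul_of_nonneg_right h1 (mul_nonneg h0 (neg_nonneg.2 hb.le))
    nlinarith
  · rw [le_div_iff₀ hb]
    have h1 : Real.exp (-(|β| * b)) ≤ 1 := Real.exp_le_one_iff.2 (by
      have := mul_nonneg (abs_nonneg β) (h0.trans hv)
      linarith)
    have h2 := Real.add_one_le_exp (β * v)
    nlinarith [mul_le_mul_of_nonneg_right h1 (mul_nonneg h0 hb.le)]

theorem expUtil_le {β v : ℝ} (hβ : β ≠ 0) (h0 : 0 ≤ v) :
    expUtil β v ≤ Real.exp (|β| * v) * v := by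
  unfold expUtil
  rcases lt_or_gt_of_ne hβ with hb | hb
  · rw [div_le_iff_of_neg hb]
    have h1 : 1 ≤ Real.exp (|β| * v) := Real.one_le_exp (by positivity)
    have h2 := Real.add_one_le_exp (β * v)
    nlinarith [mul_le_mul_of_nonneg_right h1 (mul_nonneg h0 (neg_nonneg.2 hb.le))]
  · rw [div_le_iff₀ hb, abs_of_pos hb]
    have h2 := Real.add_one_le_exp (-(β * v))
    have h3 : Real.exp (β * v) * Real.exp (-(β * v)) = 1 := by rw [← Real.exp_add]; simp
    have h4 := mul_le_mul_of_nonneg_left h2 (Real.exp_pos (β * v)).le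
    nlinarith

/-- The difference of transforms is e^{βu} times the transform of v - u; each of these two steps
loses at most a factor e^{-|β|b}. -/
theorem sub_le_expUtil_sub {β u v b : ℝ} (hβ : β ≠ 0) (h0 : 0 ≤ u) (huv : u ≤ v) (hv : v ≤ b) :
    v - u ≤ Real.exp (2 * (|β| * b)) * (expUtil β v - expUtil β u) := by
  have h1 : expUtil β v - expUtil β u = Real.exp (β * u) * expUtil β (v - u) := by
    have := expUtil_add hβ u (v - u)
    rw [add_sub_cancel] at this
    linarith
  have h2 := exp_neg_abs_mul_le (β := β) ((abs_of_nonneg h0).trans_le (huv.trans hv))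
  have h3 := le_expUtil hβ (sub_nonneg.2 huv) (show v - u ≤ b by linarith)
  have h4 : Real.exp (2 * (|β| * b)) * (Real.exp (-(|β| * b)) * Real.exp (-(|β| * b))) = 1 := by
    rw [← Real.exp_add, ← Real.exp_add, Real.exp_eq_one_iff]; ring
  calc v - u = Real.exp (2 * (|β| * b)) * (Real.exp (-(|β| * b)) *
        (Real.exp (-(|β| * b)) * (v - u))) := by
        rw [← mul_assoc (Real.exp (-(|β| * b))), ← mul_assoc, h4, one_mul]
    _ ≤ _ := by
      rw [h1]
      have := expUtil_nonneg hβ (sub_nonneg.2 huv)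
      gcongr

/-- Expresses the scale of the bonus as the transform of the largest possible value, without a case
split on the sign of β. -/
theorem abs_exp_sub_one_div_abs {β b : ℝ} (hβ : β ≠ 0) (hb : 0 ≤ b) :
    |Real.exp (β * b) - 1| / |β| = expUtil β b := by
  rw [← abs_div, ← expUtil, abs_of_nonneg (expUtil_nonneg hβ hb)]

theorem expUtil_log {β m : ℝ} (hβ : β ≠ 0) (hm : 0 < m) :
    expUtil β (1 / β * Real.log m) = (m - 1) / β := by
  rw [expUtil, ← mul_assoc, mul_one_div_cancel hβ, one_mul, Real.exp_log hm]

end ExpUtil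

/-! ### Policy values in the transformed scale -/

section Values

variable {S A : Type*} {H : ℕ} [Fintype S]

theorem utilValue_nonneg {β : ℝ} (hβ : β ≠ 0) (κ : Fin H → S → PMF S) {ρ : Fin H → S → ℝ}
    (hρ : ∀ h s, 0 ≤ ρ h s) (s : S) : 0 ≤ utilValue β κ ρ s := by
  have : utilValue β κ ρ s =
      expect (pathLaw H κ s) fun x => expUtil β (∑ h, ρ h (x h.castSucc)) := by
    simp only [expUtil, div_eq_inv_mul]
    rw [expect_const_mul, expect_sub, expect_const, utilValue, div_eq_inv_mul]
  rw [this]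
  exact expect_nonneg fun x => expUtil_nonneg hβ (Finset.sum_nonneg fun h _ => hρ _ _)

theorem expUtil_value {β : ℝ} (hβ : β ≠ 0) (M : EpisodicMDP S A H) (π : Policy S A H) (s : S) :
    expUtil β (M.value β π s) =
      utilValue β (fun h x => M.P h x (π h x)) (fun h x => M.r h x (π h x)) s := by
  set U := expect (M.episodeLaw π s) fun x => Real.exp (β * M.totalReward π x) with hU
  have hpos : 0 < U := by
    refine (Real.exp_pos (-(|β| * H))).trans_le ?_
    rw [← expect_const (M.episodeLaw π s) (Real.exp (-(|β| * H)))]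
    refine expect_mono fun x => exp_neg_abs_mul_le ?_
    rw [EpisodicMDP.totalReward, abs_of_nonneg (Finset.sum_nonneg fun h _ => M.r_nonneg _ _ _)]
    calc _ ≤ ∑ _h : Fin H, (1 : ℝ) :=
          Finset.sum_le_sum fun h _ => M.r_le_one _ _ _
      _ = H := by simp
  exact expUtil_log hβ hpos

end Values

/-! ### Analysis of the value estimates: optimism and regret of one episode -/

section Estimate

variable {S A : Type*} {H : ℕ}

/-- The normal equation of the least-squares problem. -/
theorem visits_mul_of_isMinOn {M : EpisodicMDP S A H} {β : ℝ} {n : ℕ} {D : Fin n → Episode S A H}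
    {h : Fin H} {V : S → ℝ} {w : S × A → ℝ} (hw : IsMinOn (lsObjective M β D h V) Set.univ w)
    (s : S) (a : A) : visits D h s a * w (s, a) =
      ∑ τ, hit h s a (D τ) * Real.exp (β * (M.r h s a + V ((D τ).next h))) := by
  classical
  set T := ∑ τ, hit h s a (D τ) * (Real.exp (β * (M.r h s a + V ((D τ).next h))) - w (s, a))
    with hT
  have hTe : T = ∑ τ, hit h s a (D τ) * Real.exp (β * (M.r h s a + V ((D τ).next h))) -
      visits D h s a * w (s, a) := by
    rw [← sum_hit, Finset.sum_mul, ← Finset.sum_sub_distrib]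
    exact Finset.sum_congr rfl fun τ _ => mul_sub _ _ _
  -- Perturb the minimizer by t in the single coordinate (s, a). The change of the objective, Nt² -
  -- 2tT, is nonnegative for all t, which forces T = 0; for N = 0 it is linear in t.
  have hquad : ∀ t : ℝ, 0 ≤ visits D h s a * t ^ 2 - 2 * t * T := fun t => by
    have h1 := hw (Set.mem_univ (Function.update w (s, a) (w (s, a) + t)))
    rw [Set.mem_ofPred_eq, ← sub_nonneg, lsObjective, lsObjective,
      ← Finset.sum_sub_distrib] at h1
    refine h1.trans_eq ?_
    rw [← sum_hit, hT, Finset.sum_mul, Finset.mul_sum, ← Finset.sum_sub_distrib]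
    refine Finset.sum_congr rfl fun τ _ => ?_
    by_cases hτ : (D τ).at h = s ∧ (D τ).action h = a
    · simp only [hit, hτ, and_self, if_true, Function.update_self]
      ring
    · have : ((D τ).at h, (D τ).action h) ≠ (s, a) := fun h => hτ (Prod.mk.inj h)
      simp [hit, hτ]
  have hT0 : T = 0 := by
    by_contra hne
    have hpos : 0 < T ^ 2 := by positivity
    rcases Nat.eq_zero_or_pos (visits D h s a) with h0 | h0
    · have := hquad T
      rw [h0] at this
      push_cast at this
      nlinarith
    · have h0' : (0 : ℝ) < visits D h s a := by exact_mod_cast h0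
      have := hquad (T / visits D h s a)
      have h2 : visits D h s a * (T / visits D h s a) ^ 2 - 2 * (T / visits D h s a) * T =
          -(T ^ 2 / visits D h s a) := by field_simp; ring
      rw [h2] at this
      have := div_pos hpos h0'
      linarith
  linarith

variable [Fintype S]

/-- The left side is a linear form Σ d(x) f(x), largest over 0 ≤ f ≤ R at R times the indicator of
{d > 0}. The bound on sets thus covers every `f` at once, including an `f` computed from the data.
-/
theorem sum_hit_mul_sub_le {M : EpisodicMDP S A H} {L : ℝ} {n : ℕ} {D : Fin n → Episode S A H}
    (hD : Accurate M L D) (h : Fin H) (s : S) (a : A) {f : S → ℝ} {R : ℝ} (h0 : ∀ x, 0 ≤ f x)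
    (hR : ∀ x, f x ≤ R) :
    ∑ τ, hit h s a (D τ) * (f ((D τ).next h) - expect (M.P h s a) f) ≤
      R * (2 * √(visits D h s a * L)) := by
  classical
  have hR0 : 0 ≤ R := (h0 s).trans (hR s)
  set d : S → ℝ := fun x => ∑ τ, hit h s a (D τ) *
    ((if (D τ).next h = x then 1 else 0) - (M.P h s a x).toReal) with hd
  have hlin : ∀ g : S → ℝ, ∑ τ, hit h s a (D τ) * (g ((D τ).next h) - expect (M.P h s a) g) =
      ∑ x, d x * g x := fun g => by
    simp only [hd, Finset.sum_mul]
    rw [Finset.sum_comm]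
    refine Finset.sum_congr rfl fun τ _ => ?_
    simp only [mul_assoc, ← Finset.mul_sum, sub_mul, Finset.sum_sub_distrib, expect]
    simp
  set B := Finset.univ.filter fun x => 0 < d x with hB
  have hdev := hD h s a B
  have heq : ∑ τ, deviation M h s a B (D τ) = ∑ x ∈ B, d x := by
    calc _ = ∑ τ, hit h s a (D τ) * (ind B ((D τ).next h) - expect (M.P h s a) (ind B)) := by
          refine Finset.sum_congr rfl fun τ _ => ?_
          unfold deviation hit
          split_ifs <;> simp
      _ = ∑ x ∈ B, d x := by rw [hlin]; simp [ind]
  rw [heq] at hdev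
  calc _ = ∑ x, d x * f x := hlin f
    _ ≤ ∑ x, if x ∈ B then d x * R else 0 := Finset.sum_le_sum fun x _ => by
        split_ifs with hx
        · have : 0 < d x := (Finset.mem_filter.1 hx).2
          gcongr
          exact hR x
        · have : d x ≤ 0 := not_lt.1 fun h => hx (Finset.mem_filter.2 ⟨Finset.mem_univ _, h⟩)
          exact mul_nonpos_of_nonpos_of_nonneg this (h0 x)
    _ = R * ∑ x ∈ B, d x := by
        rw [Finset.sum_ite_mem, Finset.univ_inter, ← Finset.sum_mul, mul_comm]
    _ ≤ _ := by gcongr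

/-- Empirical averages of bounded functions are close to their conditional means. -/
theorem abs_average_sub_le {M : EpisodicMDP S A H} {L : ℝ} {n : ℕ}
    {D : Fin n → Episode S A H} (hD : Accurate M L D) (h : Fin H) (s : S) (a : A)
    (hN : 1 ≤ visits D h s a) {f : S → ℝ} {R : ℝ} (h0 : ∀ x, 0 ≤ f x) (hR : ∀ x, f x ≤ R) :
    |(∑ τ, hit h s a (D τ) * f ((D τ).next h)) / visits D h s a - expect (M.P h s a) f| ≤
      R * (2 * √(L / visits D h s a)) := by
  have hN0 : (0 : ℝ) < visits D h s a := by exact_mod_cast hN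
  have h1 := sum_hit_mul_sub_le hD h s a h0 hR
  -- The reflection R - f turns the one-sided bound into the opposite one.
  have h2 := sum_hit_mul_sub_le hD h s a (f := fun x => R - f x) (R := R)
    (fun x => sub_nonneg.2 (hR x)) (fun x => by linarith [h0 x])
  have h3 : √(visits D h s a * L) = visits D h s a * √(L / visits D h s a) := by
    rw [show (visits D h s a * L : ℝ) = (visits D h s a : ℝ) ^ 2 * (L / visits D h s a) by
      field_simp, Real.sqrt_mul (by positivity), Real.sqrt_sq hN0.le]
  have h4 : ∑ τ, hit h s a (D τ) * (f ((D τ).next h) - expect (M.P h s a) f) =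
      ∑ τ, hit h s a (D τ) * f ((D τ).next h) - visits D h s a * expect (M.P h s a) f := by
    rw [← sum_hit, Finset.sum_mul, ← Finset.sum_sub_distrib]
    exact Finset.sum_congr rfl fun τ _ => mul_sub _ _ _
  have h5 : ∑ τ, hit h s a (D τ) *
      ((fun x => R - f x) ((D τ).next h) - expect (M.P h s a) fun x => R - f x) =
      -∑ τ, hit h s a (D τ) * (f ((D τ).next h) - expect (M.P h s a) f) := by
    rw [expect_sub, expect_const, ← Finset.sum_neg_distrib]
    exact Finset.sum_congr rfl fun τ _ => by ring
  rw [h5, h4, h3] at h2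
  rw [h4, h3] at h1
  rw [abs_le]
  constructor
  · rw [le_sub_iff_add_le, le_div_iff₀ hN0]; linarith
  · rw [sub_le_iff_le_add, div_le_iff₀ hN0]; linarith

variable [Fintype A] {M : EpisodicMDP S A H} {K : ℕ} {c δ β : ℝ} {n : ℕ}
  {D : Fin n → Episode S A H} {w : Fin H → S × A → ℝ} {Q : Fin H → S → A → ℝ}
  {V : Fin (H + 1) → S → ℝ}

theorem bonus_nonneg (hc : 0 ≤ c) (N : ℕ) : 0 ≤ bonus S A H K c δ β N := by
  unfold bonus; positivity

/-- Unifies the two signs: for β < 0, division by β reverses the order, so the maximum becomes a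
minimum and the subtracted bonus an added one. The normal equation identifies `w` with an empirical
average. -/
theorem IsRSVIEstimate.expUtil_Q (E : IsRSVIEstimate M K c δ β D w Q V) (hβ : β ≠ 0) (hc : 0 ≤ c)
    (h : Fin H) (s : S) (a : A) (hN : 1 ≤ visits D h s a) :
    expUtil β (Q h s a) = min (expUtil β ((H : ℝ) - (h : ℕ)))
      (expUtil β (M.r h s a) + Real.exp (β * M.r h s a) *
        ((∑ τ, hit h s a (D τ) * expUtil β (V h.succ ((D τ).next h))) / visits D h s a) +
      bonus S A H K c δ β (visits D h s a) / |β|) := by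
  have hN0 : (0 : ℝ) < visits D h s a := by exact_mod_cast hN
  have hw := visits_mul_of_isMinOn (E.w_min h) s a
  have hwe : expUtil β (M.r h s a) + Real.exp (β * M.r h s a) *
      ((∑ τ, hit h s a (D τ) * expUtil β (V h.succ ((D τ).next h))) / visits D h s a) =
      (w h (s, a) - 1) / β := by
    have h1 : ∑ τ, hit h s a (D τ) * expUtil β (V h.succ ((D τ).next h)) =
        (∑ τ, hit h s a (D τ) * Real.exp (β * V h.succ ((D τ).next h)) - visits D h s a) / β := by
      rw [← sum_hit, ← Finset.sum_sub_distrib, Finset.sum_div]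
      exact Finset.sum_congr rfl fun τ _ => by rw [expUtil]; ring
    have h2 : ∑ τ, hit h s a (D τ) * Real.exp (β * (M.r h s a + V h.succ ((D τ).next h))) =
        Real.exp (β * M.r h s a) *
          ∑ τ, hit h s a (D τ) * Real.exp (β * V h.succ ((D τ).next h)) := by
      rw [Finset.mul_sum]
      exact Finset.sum_congr rfl fun τ _ => by rw [mul_add, Real.exp_add]; ring
    rw [h2] at hw
    have h3 : w h (s, a) = Real.exp (β * M.r h s a) *
        (∑ τ, hit h s a (D τ) * Real.exp (β * V h.succ ((D τ).next h))) / visits D h s a := by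
      rw [← hw]; field_simp
    rw [h1, h3, expUtil]
    field_simp
    ring
  -- Needed for β > 0, where the logarithm can be undone only if its argument is positive.
  have hwpos : 0 < w h (s, a) := by
    have hnn : ∀ τ, 0 ≤ hit h s a (D τ) := fun τ => by unfold hit; split_ifs <;> norm_num
    have hs : 0 < ∑ τ, hit h s a (D τ) := by rw [sum_hit]; exact hN0
    obtain ⟨τ, -, hτ⟩ := Finset.exists_lt_of_sum_lt (f := fun _ => (0 : ℝ)) (by simpa using hs)
    refine pos_of_mul_pos_right (hw.symm ▸ Finset.sum_pos' (fun τ _ => mul_nonneg (hnn τ)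
      (Real.exp_pos _).le) ⟨τ, Finset.mem_univ _, mul_pos hτ (Real.exp_pos _)⟩) hN0.le
  have hb : 0 ≤ bonus S A H K c δ β (visits D h s a) := bonus_nonneg hc _
  rw [hwe]
  rcases lt_or_gt_of_ne hβ with hneg | hpos
  · rw [E.Q_averse hneg h s a hN, expUtil_log hβ (lt_max_of_lt_left (Real.exp_pos _)), expUtil,
      abs_of_neg hneg, show ∀ x y : ℝ, (x - 1) / β + y / -β = (x - y - 1) / β by
        intro x y; field_simp; ring]
    rcases le_total (Real.exp (β * ((H : ℝ) - (h : ℕ))))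
      (w h (s, a) - bonus S A H K c δ β (visits D h s a)) with hle | hle
    · rw [max_eq_right hle, min_eq_right (div_le_div_of_nonpos_of_le hneg.le (by linarith))]
    · rw [max_eq_left hle, min_eq_left (div_le_div_of_nonpos_of_le hneg.le (by linarith))]
  · rw [E.Q_seeking hpos h s a hN, expUtil_log hβ (lt_min (Real.exp_pos _) (by linarith)), expUtil,
      abs_of_pos hpos, ← add_div, min_div_div_right hpos.le,
      show w h (s, a) - 1 + bonus S A H K c δ β (visits D h s a) =
        w h (s, a) + bonus S A H K c δ β (visits D h s a) - 1 by ring, min_sub_sub_right]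

theorem IsRSVIEstimate.Q_le (E : IsRSVIEstimate M K c δ β D w Q V) (hβ : β ≠ 0) (hc : 0 ≤ c)
    (h : Fin H) (s : S) (a : A) : Q h s a ≤ (H : ℝ) - (h : ℕ) := by
  rcases Nat.eq_zero_or_pos (visits D h s a) with h0 | h0
  · exact (E.Q_unvisited h s a h0).le
  · rw [← (expUtil_strictMono hβ).le_iff_le, E.expUtil_Q hβ hc h s a h0]
    exact min_le_left _ _

theorem IsRSVIEstimate.V_le (E : IsRSVIEstimate M K c δ β D w Q V) (hβ : β ≠ 0) (hc : 0 ≤ c)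
    (h : Fin (H + 1)) (s : S) : V h s ≤ (H : ℝ) - (h : ℕ) := by
  induction h using Fin.lastCases with
  | last => rw [E.V_last]; simp
  | cast h =>
    obtain ⟨a, ha⟩ := (E.V_max h s).1
    exact ha ▸ E.Q_le hβ hc h s a

theorem IsRSVIEstimate.V_nonneg (E : IsRSVIEstimate M K c δ β D w Q V) (hβ : β ≠ 0) (hc : 0 ≤ c)
    (h : Fin (H + 1)) (s : S) : 0 ≤ V h s := by
  induction h using Fin.reverseInduction generalizing s with
  | last => rw [E.V_last]
  | cast h ih =>
    obtain ⟨a, ha⟩ := (E.V_max h s).1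
    have hh : (0 : ℝ) ≤ (H : ℝ) - (h : ℕ) := sub_nonneg.2 (by exact_mod_cast h.isLt.le)
    simp only at ha
    rw [← ha]
    rcases Nat.eq_zero_or_pos (visits D h s a) with h0 | h0
    · rwa [E.Q_unvisited h s a h0]
    · rw [← (expUtil_strictMono hβ).le_iff_le, E.expUtil_Q hβ hc h s a h0, expUtil_zero]
      refine le_min (expUtil_nonneg hβ hh) ?_
      have h1 := expUtil_nonneg hβ (M.r_nonneg h s a)
      have h2 : 0 ≤ ∑ τ, hit h s a (D τ) * expUtil β (V h.succ ((D τ).next h)) :=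
        Finset.sum_nonneg fun τ _ => mul_nonneg (by unfold hit; split_ifs <;> norm_num)
          (expUtil_nonneg hβ (ih _))
      have h3 := bonus_nonneg (S := S) (A := A) (H := H) (K := K) (δ := δ) (β := β) hc
        (visits D h s a)
      positivity

/-- A bound, relative to the scale of the values, on the cost of the uncertainty about a pair
visited `N` times, where `b` is the product of the number of states and the logarithmic term. -/
noncomputable def uncertainty (b : ℝ) (N : ℕ) : ℝ := min 1 (20 * √(b / (max N 1 : ℕ)))

theorem uncertainty_nonneg (b : ℝ) (N : ℕ) : 0 ≤ uncertainty b N := by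
  unfold uncertainty; positivity

theorem uncertainty_le_one (b : ℝ) (N : ℕ) : uncertainty b N ≤ 1 := min_le_left _ _

/-- The one-step Bellman update of `V` in the transformed scale. -/
noncomputable def bellman (M : EpisodicMDP S A H) (β : ℝ) (V : Fin (H + 1) → S → ℝ) (h : Fin H)
    (s : S) (a : A) : ℝ :=
  expUtil β (M.r h s a) +
    Real.exp (β * M.r h s a) * expect (M.P h s a) fun x => expUtil β (V h.succ x)

theorem IsRSVIEstimate.bellman_nonneg (E : IsRSVIEstimate M K c δ β D w Q V) (hβ : β ≠ 0)
    (hc : 0 ≤ c) (h : Fin H) (s : S) (a : A) : 0 ≤ bellman M β V h s a := by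
  have h1 := expUtil_nonneg hβ (M.r_nonneg h s a)
  have h2 : 0 ≤ expect (M.P h s a) fun x => expUtil β (V h.succ x) :=
    expect_nonneg fun x => expUtil_nonneg hβ (E.V_nonneg hβ hc _ x)
  unfold bellman
  positivity

/-- The true update never exceeds the cap, so capping cannot destroy optimism. -/
theorem IsRSVIEstimate.bellman_le (E : IsRSVIEstimate M K c δ β D w Q V) (hβ : β ≠ 0)
    (hc : 0 ≤ c) (h : Fin H) (s : S) (a : A) :
    bellman M β V h s a ≤ expUtil β ((H : ℝ) - (h : ℕ)) := by
  have h1 : (expect (M.P h s a) fun x => expUtil β (V h.succ x)) ≤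
      expUtil β ((H : ℝ) - (h.succ : ℕ)) := by
    rw [← expect_const (M.P h s a) (expUtil β ((H : ℝ) - (h.succ : ℕ)))]
    exact expect_mono fun x => (expUtil_strictMono hβ).monotone (E.V_le hβ hc _ x)
  calc bellman M β V h s a ≤ expUtil β (M.r h s a) +
        Real.exp (β * M.r h s a) * expUtil β ((H : ℝ) - (h.succ : ℕ)) := by
        unfold bellman; gcongr
    _ = expUtil β (M.r h s a + ((H : ℝ) - (h.succ : ℕ))) := (expUtil_add hβ _ _).symm
    _ ≤ _ := (expUtil_strictMono hβ).monotone (by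
      rw [Fin.val_succ]; push_cast; linarith [M.r_le_one h s a])

/-- The deviation of the estimated Bellman update from the true one is covered by the bonus. -/
theorem IsRSVIEstimate.abs_estimate_sub_bellman_le (E : IsRSVIEstimate M K 10 δ β D w Q V)
    (hβ : β ≠ 0) (hH : 0 < H) (hβH : |β| * H ≤ 1)
    (hD : Accurate M (3 * (Fintype.card S * logTerm S A H K δ)) D)
    (h : Fin H) (s : S) (a : A) (hN : 1 ≤ visits D h s a) :
    |expUtil β (M.r h s a) + Real.exp (β * M.r h s a) *
        ((∑ τ, hit h s a (D τ) * expUtil β (V h.succ ((D τ).next h))) / visits D h s a) -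
      bellman M β V h s a| ≤ bonus S A H K 10 δ β (visits D h s a) / |β| := by
  set b : ℝ := Fintype.card S * logTerm S A H K δ with hb
  have hH1 : (1 : ℝ) ≤ H := by exact_mod_cast hH
  have hβ1 : |β| ≤ 1 := (le_mul_of_one_le_right (abs_nonneg β) hH1).trans hβH
  have hHn : (0 : ℝ) ≤ H := Nat.cast_nonneg H
  have hφ := expUtil_nonneg hβ hHn
  have h1 := abs_average_sub_le hD h s a hN (f := fun x => expUtil β (V h.succ x))
    (R := expUtil β H) (fun x => expUtil_nonneg hβ (E.V_nonneg hβ (by norm_num) _ x))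
    (fun x => (expUtil_strictMono hβ).monotone ((E.V_le hβ (by norm_num) _ x).trans
      (sub_le_self _ (Nat.cast_nonneg _))))
  have hexp : Real.exp (β * M.r h s a) ≤ 2.7183 := by
    refine (exp_mul_le (b := 1) ?_).trans (?_ : Real.exp (|β| * 1) ≤ 2.7183)
    · rw [abs_of_nonneg (M.r_nonneg h s a)]; exact M.r_le_one h s a
    · calc Real.exp (|β| * 1) ≤ Real.exp 1 := by gcongr; simpa using hβ1
        _ ≤ 2.7183 := by linarith [Real.exp_one_lt_d9]
  have hbon : bonus S A H K 10 δ β (visits D h s a) / |β| =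
      10 * expUtil β H * √(b / visits D h s a) := by
    rw [← abs_exp_sub_one_div_abs hβ hHn, bonus]
    ring
  have h3 : √(3 : ℝ) ≤ 1.7321 := by rw [Real.sqrt_le_left (by norm_num)]; norm_num
  rw [bellman, add_sub_add_left_eq_sub, ← mul_sub, abs_mul, abs_of_pos (Real.exp_pos _), hbon]
  -- The bonus constant 10 covers 2e√3 ≈ 9.42: e bounds e^{βr}, 2 comes from the deviation bound and
  -- √3 from the 3 in the accuracy level.
  calc _ ≤ 2.7183 * (expUtil β H * (2 * √(3 * b / visits D h s a))) := by gcongr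
    _ = 2.7183 * (expUtil β H * (2 * (√3 * √(b / visits D h s a)))) := by
      rw [mul_div_assoc, Real.sqrt_mul (by norm_num)]
    _ ≤ 2.7183 * (expUtil β H * (2 * (1.7321 * √(b / visits D h s a)))) := by gcongr
    _ ≤ _ := by nlinarith [mul_nonneg hφ (Real.sqrt_nonneg (b / visits D h s a))]

/-- Optimism of the estimated action values. -/
theorem IsRSVIEstimate.bellman_le_Q (E : IsRSVIEstimate M K 10 δ β D w Q V)
    (hβ : β ≠ 0) (hH : 0 < H) (hβH : |β| * H ≤ 1)
    (hD : Accurate M (3 * (Fintype.card S * logTerm S A H K δ)) D)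
    (h : Fin H) (s : S) (a : A) : bellman M β V h s a ≤ expUtil β (Q h s a) := by
  have h1 := E.bellman_le hβ (by norm_num) h s a
  rcases Nat.eq_zero_or_pos (visits D h s a) with h0 | h0
  · rwa [E.Q_unvisited h s a h0]
  · rw [E.expUtil_Q hβ (by norm_num) h s a h0]
    have h2 := E.abs_estimate_sub_bellman_le hβ hH hβH hD h s a h0
    exact le_min h1 (by linarith [(abs_le.1 h2).1])

/-- The excess is at most twice the bonus, which gives the 20 in `uncertainty`. The truncation at 1
comes from the trivial bound by the cap and keeps path uncertainties bounded. -/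
theorem IsRSVIEstimate.Q_le_bellman (E : IsRSVIEstimate M K 10 δ β D w Q V)
    (hβ : β ≠ 0) (hH : 0 < H) (hβH : |β| * H ≤ 1)
    (hb : 1 / 2 ≤ Fintype.card S * logTerm S A H K δ)
    (hD : Accurate M (3 * (Fintype.card S * logTerm S A H K δ)) D)
    (h : Fin H) (s : S) (a : A) : expUtil β (Q h s a) ≤ bellman M β V h s a +
      expUtil β H * uncertainty (Fintype.card S * logTerm S A H K δ) (visits D h s a) := by
  have hHn : (0 : ℝ) ≤ H := Nat.cast_nonneg H
  have hφ := expUtil_nonneg hβ hHn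
  have h1 := E.bellman_nonneg hβ (by norm_num) h s a
  have h2 : expUtil β (Q h s a) ≤ expUtil β H := (expUtil_strictMono hβ).monotone
    ((E.Q_le hβ (by norm_num) h s a).trans (sub_le_self _ (Nat.cast_nonneg _)))
  rw [uncertainty, mul_min_of_nonneg _ _ hφ, ← min_add_add_left]
  refine le_min (by linarith) ?_
  rcases Nat.eq_zero_or_pos (visits D h s a) with h0 | h0
  -- For an unvisited pair the count is replaced by 1, and 20√b ≥ 1 makes the trivial bound
  -- sufficient.
  · have h3 : (1 / 20 : ℝ) ≤ √(Fintype.card S * logTerm S A H K δ / (max 0 1 : ℕ)) := by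
      apply Real.le_sqrt_of_sq_le
      norm_num
      linarith
    rw [h0]
    nlinarith [mul_le_mul_of_nonneg_left h3 hφ]
  · have h3 := E.abs_estimate_sub_bellman_le hβ hH hβH hD h s a h0
    have hbon : bonus S A H K 10 δ β (visits D h s a) / |β| =
        10 * expUtil β H * √(Fintype.card S * logTerm S A H K δ / visits D h s a) := by
      rw [← abs_exp_sub_one_div_abs hβ hHn, bonus]
      ring
    rw [max_eq_left h0, E.expUtil_Q hβ (by norm_num) h s a h0]
    refine (min_le_right _ _).trans ?_
    rw [hbon] at h3 ⊢
    linarith [(abs_le.1 h3).2]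

/-- The regret of the greedy policy in one episode is controlled by its expected uncertainty. -/
theorem IsRSVIEstimate.optValue_sub_value_le [Nonempty A]
    (E : IsRSVIEstimate M K 10 δ β D w Q V)
    (hβ : β ≠ 0) (hH : 0 < H) (hβH : |β| * H ≤ 1)
    (hb : 1 / 2 ≤ Fintype.card S * logTerm S A H K δ)
    (hD : Accurate M (3 * (Fintype.card S * logTerm S A H K δ)) D)
    {π : Policy S A H} (hπ : ∀ h s a, Q h s a ≤ Q h s (π h s)) (s : S) :
    M.optValue β s - M.value β π s ≤ 55 * H * expect (M.episodeLaw π s) fun x =>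
      ∑ h, uncertainty (Fintype.card S * logTerm S A H K δ)
        (visits D h (x h.castSucc) (π h (x h.castSucc))) := by
  have hHn : (0 : ℝ) ≤ H := Nat.cast_nonneg H
  have hφ := expUtil_nonneg hβ hHn
  have hmono := expUtil_strictMono hβ
  have hopt : ∀ π' : Policy S A H, M.value β π' s ≤ V 0 s := fun π' => by
    rw [← hmono.le_iff_le, expUtil_value hβ]
    refine utilValue_le hβ _ _ (fun h s => expUtil β (V h s))
      (fun s => by simp only [E.V_last, expUtil_zero, le_refl]) (fun h s => ?_) s
    refine (E.bellman_le_Q hβ hH hβH hD h s (π' h s)).trans (hmono.monotone ?_)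
    exact (E.V_max h s).2 ⟨_, rfl⟩
  have h1 : M.optValue β s ≤ V 0 s := ciSup_le hopt
  have hu : 0 ≤ M.value β π s := by
    rw [← hmono.le_iff_le, expUtil_value hβ, expUtil_zero]
    exact utilValue_nonneg hβ _ (fun h s => M.r_nonneg _ _ _) s
  have hv : V 0 s ≤ H := by simpa using E.V_le hβ (by norm_num) 0 s
  have h2 := sub_le_expUtil_sub hβ hu (hopt π) hv
  have h3 := sub_utilValue_le hβ (fun h x => M.P h x (π h x)) (fun h x => M.r h x (π h x))
    (fun h s => expUtil β (V h s))
    (fun h s => expUtil β H * uncertainty (Fintype.card S * logTerm S A H K δ)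
      (visits D h s (π h s)))
    (fun h s => by rw [abs_of_nonneg (M.r_nonneg _ _ _)]; exact M.r_le_one _ _ _)
    (fun h s => mul_nonneg hφ (uncertainty_nonneg _ _))
    (fun s => by simp only [E.V_last, expUtil_zero, le_refl])
    (fun h s => by
      obtain ⟨a, ha⟩ := (E.V_max h s).1
      simp only at ha
      rw [← ha]
      exact (hmono.monotone (hπ h s a)).trans (E.Q_le_bellman hβ hH hβH hb hD h s (π h s))) s
  rw [← expUtil_value hβ] at h3
  simp only [← Finset.mul_sum] at h3
  rw [expect_const_mul] at h3
  set G := expect (M.episodeLaw π s) fun x =>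
      ∑ h, uncertainty (Fintype.card S * logTerm S A H K δ)
        (visits D h (x h.castSucc) (π h (x h.castSucc))) with hG
  have hG0 : 0 ≤ G := expect_nonneg fun x => Finset.sum_nonneg fun h _ => uncertainty_nonneg _ _
  change _ ≤ _ * (_ * G) at h3
  have h4 : expUtil β H ≤ Real.exp (|β| * H) * H := expUtil_le hβ hHn
  -- Four factors e^{|β|H} ≤ e: two from leaving the transformed scale, one from the recursion, one
  -- from the transform of H. Numerically e⁴ < 55.
  have h5 : Real.exp (2 * (|β| * H)) * (Real.exp (|β| * H) * Real.exp (|β| * H)) ≤ 55 := by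
    rw [← Real.exp_add, ← Real.exp_add]
    calc _ ≤ Real.exp ((4 : ℕ) * 1) := by gcongr; push_cast; linarith
      _ = Real.exp 1 ^ 4 := Real.exp_nat_mul _ _
      _ ≤ 2.7183 ^ 4 := by gcongr; linarith [Real.exp_one_lt_d9]
      _ ≤ 55 := by norm_num
  calc _ ≤ V 0 s - M.value β π s := by linarith
    _ ≤ Real.exp (2 * (|β| * H)) * (expUtil β (V 0 s) - expUtil β (M.value β π s)) := h2
    _ ≤ Real.exp (2 * (|β| * H)) * (Real.exp (|β| * H) * ((Real.exp (|β| * H) * H) * G)) := by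
      gcongr
      exact h3.trans (by gcongr)
    _ = Real.exp (2 * (|β| * H)) * (Real.exp (|β| * H) * Real.exp (|β| * H)) * (H * G) := by ring
    _ ≤ 55 * (H * G) := by gcongr
    _ = _ := by ring

end Estimate


/-! ### Pigeonhole bound for the sum of uncertainties -/

section Pigeonhole

/-- Prepares telescoping. The constant 3 comes from √(N+1) + √N ≤ 3√N for N ≥ 1, and also covers N =
0. -/
theorem inv_sqrt_max_le (N : ℕ) : 1 / √(max N 1 : ℕ) ≤ 3 * (√((N : ℝ) + 1) - √N) := by
  rcases Nat.eq_zero_or_pos N with rfl | h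
  · norm_num
  · rw [max_eq_left h]
    have hN : (1 : ℝ) ≤ N := by exact_mod_cast h
    have h0 : 0 < √(N : ℝ) := Real.sqrt_pos.2 (by linarith)
    have h1 : √((N : ℝ) + 1) ≤ 2 * √N := by
      rw [Real.sqrt_le_left (by positivity), mul_pow, Real.sq_sqrt (by linarith)]
      linarith
    have h2 : (√((N : ℝ) + 1) - √N) * (√((N : ℝ) + 1) + √N) = 1 := by
      nlinarith [Real.sq_sqrt (show (0 : ℝ) ≤ N + 1 by linarith), Real.sq_sqrt (show (0 : ℝ) ≤ N by linarith)]
    have h3 : 0 ≤ √((N : ℝ) + 1) - √N := sub_nonneg.2 (Real.sqrt_le_sqrt (by linarith))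
    rw [div_le_iff₀ h0]
    nlinarith [mul_le_mul_of_nonneg_left h1 h3]

variable {S A : Type*} {H : ℕ}

theorem visits_snoc {K : ℕ} (D : Fin K → Episode S A H) (e : Episode S A H) (h : Fin H) (s : S)
    (a : A) : (visits (Fin.snoc D e : Fin (K + 1) → Episode S A H) h s a : ℝ) =
      visits D h s a + hit h s a e := by
  simp only [← sum_hit, Fin.sum_univ_castSucc, Fin.snoc_castSucc, Fin.snoc_last]

theorem hit_self (h : Fin H) (e : Episode S A H) : hit h (e.at h) (e.action h) e = 1 := by
  simp [hit]

variable [Fintype S] [Fintype A]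

theorem sum_visits {K : ℕ} (D : Fin K → Episode S A H) (h : Fin H) :
    ∑ p : S × A, (visits D h p.1 p.2 : ℝ) = K := by
  classical
  simp only [← sum_hit]
  rw [Finset.sum_comm]
  have : ∀ τ, ∑ p : S × A, hit h p.1 p.2 (D τ) = 1 := fun τ => by
    rw [Finset.sum_eq_single ((D τ).at h, (D τ).action h)]
    · exact hit_self h _
    · rintro ⟨s, a⟩ - hne
      refine if_neg fun hh => hne ?_
      rw [hh.1, hh.2]
    · simp
  simp [this]

/-- Induction on episodes: a new episode raises exactly one count at step `h`, from N to N + 1, so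
the right side grows by 3(√(N+1) - √N). -/
theorem sum_inv_sqrt_visits_le {K : ℕ} (D : Fin K → Episode S A H) (h : Fin H) :
    ∑ k, 1 / √(max (visits (history D k) h ((D k).at h) ((D k).action h)) 1 : ℕ) ≤
      3 * ∑ p : S × A, √(visits D h p.1 p.2) := by
  classical
  induction K with
  | zero => simp [Finset.sum_nonneg]
  | succ K ih =>
    obtain ⟨D, e, rfl⟩ : ∃ D' e, D = (Fin.snoc D' e : Fin (K + 1) → Episode S A H) :=
      ⟨_, _, (Fin.snoc_init_self D).symm⟩
    simp only [Fin.sum_univ_castSucc, history_snoc_castSucc, history_snoc_last,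
      Fin.snoc_castSucc, Fin.snoc_last, Fin.val_castSucc, Fin.val_last]
    have h1 := ih D
    have h2 := inv_sqrt_max_le (visits D h (e.at h) (e.action h))
    have h3 : ∑ p : S × A, (√(visits (Fin.snoc D e : Fin (K + 1) → Episode S A H) h p.1 p.2) -
        √(visits D h p.1 p.2)) = √((visits D h (e.at h) (e.action h) : ℝ) + 1) -
          √(visits D h (e.at h) (e.action h)) := by
      rw [Finset.sum_eq_single (e.at h, e.action h)]
      · rw [visits_snoc, hit_self]
      · rintro ⟨s, a⟩ - hne
        have : hit h s a e = 0 := if_neg fun hh => hne (by rw [hh.1, hh.2])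
        rw [visits_snoc, this]
        simp
      · simp
    rw [Finset.sum_sub_distrib] at h3
    linarith

/-- Cauchy–Schwarz over the SA pairs, whose counts add up to K; 60 is 20 times the 3 of the
telescoping bound. -/
theorem sum_uncertainty_le {K : ℕ} {b : ℝ} (hb : 0 ≤ b) (D : Fin K → Episode S A H) (h : Fin H) :
    ∑ k, uncertainty b (visits (history D k) h ((D k).at h) ((D k).action h)) ≤
      60 * √(b * (Fintype.card S * Fintype.card A * K)) := by
  have h1 : ∑ p : S × A, √(visits D h p.1 p.2) ≤ √(Fintype.card S * Fintype.card A * K) := by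
    apply Real.le_sqrt_of_sq_le
    refine (sq_sum_le_card_mul_sum_sq).trans_eq ?_
    simp only [Real.sq_sqrt (Nat.cast_nonneg _), sum_visits, Finset.card_univ, Fintype.card_prod,
      Nat.cast_mul]
  calc _ ≤ ∑ k, 20 * √b *
        (1 / √(max (visits (history D k) h ((D k).at h) ((D k).action h)) 1 : ℕ)) :=
        Finset.sum_le_sum fun k _ => (min_le_right _ _).trans_eq (by
          rw [Real.sqrt_div hb]; ring)
    _ = 20 * √b * ∑ k, 1 / √(max (visits (history D k) h ((D k).at h) ((D k).action h)) 1 : ℕ) :=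
        (Finset.mul_sum _ _ _).symm
    _ ≤ 20 * √b * (3 * √(Fintype.card S * Fintype.card A * K)) := by
        gcongr
        exact (sum_inv_sqrt_visits_le D h).trans (by gcongr)
    _ = _ := by rw [Real.sqrt_mul hb]; ring

end Pigeonhole

/-! ### The logarithmic term and the failure probability -/

section LogTerm

variable (S A : Type*) [Fintype S] [Fintype A] [Nonempty S] [Nonempty A] {H K : ℕ} {δ : ℝ}

theorem one_le_card_mul (hH : 0 < H) (hK : 0 < K) :
    (1 : ℝ) ≤ Fintype.card S * Fintype.card A * ((K : ℝ) * H) := by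
  have : 0 < Fintype.card S * Fintype.card A * (K * H) :=
    Nat.mul_pos (Nat.mul_pos Fintype.card_pos Fintype.card_pos) (Nat.mul_pos hK hH)
  exact_mod_cast this

theorem log_two_div_le_logTerm (hH : 0 < H) (hK : 0 < K) (hδ : 0 < δ) :
    Real.log (2 / δ) ≤ logTerm S A H K δ := by
  unfold logTerm
  have := one_le_card_mul S A hH hK
  gcongr
  nlinarith

theorem half_le_logTerm (hH : 0 < H) (hK : 0 < K) (hδ : 0 < δ) (hδ1 : δ ≤ 1) :
    1 / 2 ≤ logTerm S A H K δ := by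
  refine le_trans ?_ (log_two_div_le_logTerm S A hH hK hδ)
  calc (1 / 2 : ℝ) ≤ Real.log 2 := by linarith [Real.log_two_gt_d9]
    _ ≤ Real.log (2 / δ) := by
      gcongr
      rw [le_div_iff₀ hδ]
      linarith

theorem failure_probability_le (hH : 0 < H) (hK : 0 < K) (hδ : 0 < δ) (hδ1 : δ ≤ 1) :
    (K : ℝ) ^ 2 * H * Fintype.card S * Fintype.card A * 2 ^ Fintype.card S *
      Real.exp (-(3 * (Fintype.card S * logTerm S A H K δ))) ≤ δ / 2 := by
  set x := Real.exp (-logTerm S A H K δ) with hx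
  have hone := one_le_card_mul S A hH hK
  have hS : 1 ≤ Fintype.card S := Fintype.card_pos
  have hSr : (1 : ℝ) ≤ Fintype.card S := by exact_mod_cast hS
  have hAr : (1 : ℝ) ≤ Fintype.card A := by exact_mod_cast (Fintype.card_pos : 0 < Fintype.card A)
  have hHr : (1 : ℝ) ≤ H := by exact_mod_cast hH
  have hKr : (1 : ℝ) ≤ K := by exact_mod_cast hK
  have hxe : x = δ / (2 * (Fintype.card S * Fintype.card A * ((K : ℝ) * H))) := by
    rw [hx, logTerm, Real.exp_neg, Real.exp_log (by positivity), inv_div]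
    congr 1; ring
  have hx0 : 0 < x := Real.exp_pos _
  have hx1 : x ≤ 1 / 2 := by
    rw [hxe, div_le_iff₀ (by positivity)]
    linarith
  have h1 : Real.exp (-(3 * (Fintype.card S * logTerm S A H K δ))) = x ^ (3 * Fintype.card S) := by
    rw [hx, ← Real.exp_nat_mul]
    congr 1; push_cast; ring
  -- Why the accuracy level carries a factor 3: of the 3S powers of x = δ/(2SAKH) ≤ 1/2, S of them
  -- cancel the 2^S sets, and the other 2S ≥ 2 supply x², which absorbs the polynomial factors and
  -- leaves δ/2.
  have h2 : x ^ (3 * Fintype.card S) ≤ (1 / 2) ^ Fintype.card S * x ^ 2 := by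
    calc x ^ (3 * Fintype.card S) = x ^ Fintype.card S * x ^ (2 * Fintype.card S) := by
          rw [← pow_add]; congr 1; ring
      _ ≤ (1 / 2) ^ Fintype.card S * x ^ 2 := by
          gcongr ?_ * ?_
          · gcongr
          · exact pow_le_pow_of_le_one hx0.le (by linarith) (by omega)
  have h3 : (2 : ℝ) ^ Fintype.card S * (1 / 2) ^ Fintype.card S = 1 := by
    rw [← mul_pow]; norm_num
  have hSA : (1 : ℝ) ≤ Fintype.card S * Fintype.card A * H :=
    one_le_mul_of_one_le_of_one_le (one_le_mul_of_one_le_of_one_le hSr hAr) hHr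
  calc _ ≤ (K : ℝ) ^ 2 * H * Fintype.card S * Fintype.card A * 2 ^ Fintype.card S *
        ((1 / 2) ^ Fintype.card S * x ^ 2) := by rw [h1]; gcongr
    _ = (K : ℝ) ^ 2 * H * Fintype.card S * Fintype.card A * x ^ 2 *
        (2 ^ Fintype.card S * (1 / 2) ^ Fintype.card S) := by ring
    _ = δ * δ / (4 * (Fintype.card S * Fintype.card A * H)) := by
        rw [h3, hxe]; field_simp; ring
    _ ≤ δ / 2 := by
        rw [div_le_div_iff₀ (by positivity) (by norm_num)]
        nlinarith [mul_le_mul_of_nonneg_left hδ1 hδ.le, mul_le_mul_of_nonneg_left hSA hδ.le]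

end LogTerm

/-! ### Assembling the regret bound -/

section Regret

variable {S A : Type*} {H : ℕ} {M : EpisodicMDP S A H} {K : ℕ} {δ β : ℝ}
  {alg : (n : ℕ) → (Fin n → Episode S A H) → Policy S A H}

/-- The uncertainty along a path of the policy chosen after the data `D`, averaged over the
steps. -/
noncomputable def pathUncertainty (alg : (n : ℕ) → (Fin n → Episode S A H) → Policy S A H) (b : ℝ)
    (n : ℕ) (D : Fin n → Episode S A H) (x : Fin (H + 1) → S) : ℝ :=
  (∑ h, uncertainty b (visits D h (x h.castSucc) (alg n D h (x h.castSucc)))) / H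

theorem pathUncertainty_nonneg (b : ℝ) (n : ℕ) (D : Fin n → Episode S A H)
    (x : Fin (H + 1) → S) : 0 ≤ pathUncertainty alg b n D x :=
  div_nonneg (Finset.sum_nonneg fun _ _ => uncertainty_nonneg _ _) (Nat.cast_nonneg _)

theorem pathUncertainty_le_one (b : ℝ) (n : ℕ) (D : Fin n → Episode S A H)
    (x : Fin (H + 1) → S) : pathUncertainty alg b n D x ≤ 1 := by
  refine div_le_one_of_le₀ ?_ (Nat.cast_nonneg _)
  calc _ ≤ ∑ _h : Fin H, (1 : ℝ) := Finset.sum_le_sum fun _ _ => uncertainty_le_one _ _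
    _ = H := by simp

variable [Fintype S] [Fintype A] [Nonempty A]

/-- The deterministic part of the argument, for a data set on which both good events hold. -/
theorem regret_le_of_accurate [Nonempty S] (halg : IsRSVI M K 10 δ β alg) (hβ : β ≠ 0)
    (hH : 0 < H) (hβH : |β| * H ≤ 1) (hK : 0 < K) (hδ : 0 < δ) (hδ1 : δ ≤ 1)
    {D : Fin K → Episode S A H} (hpol : ∀ k, (D k).policy = alg k (history D k))
    (hacc : ∀ k, Accurate M (3 * (Fintype.card S * logTerm S A H K δ)) (history D k))
    (hmean : ∑ k : Fin K, expect (M.episodeLaw (alg k (history D k)) ((D k).state 0))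
        (pathUncertainty alg (Fintype.card S * logTerm S A H K δ) k (history D k)) ≤
      2 * ∑ k : Fin K, pathUncertainty alg (Fintype.card S * logTerm S A H K δ) k (history D k)
        (D k).state + 2 * Real.log (2 / δ)) :
    regret M β D ≤ 14000 * √((H : ℝ) ^ 3 * (Fintype.card S : ℝ) ^ 2 * (Fintype.card A : ℝ) *
      ((K : ℝ) * H) * logTerm S A H K δ ^ 2) := by
  set ι := logTerm S A H K δ with hι
  set b : ℝ := Fintype.card S * ι with hb
  have hι1 : 1 / 2 ≤ ι := half_le_logTerm S A hH hK hδ hδ1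
  have hS : (1 : ℝ) ≤ Fintype.card S := by exact_mod_cast (Fintype.card_pos : 0 < Fintype.card S)
  have hA : (1 : ℝ) ≤ Fintype.card A := by exact_mod_cast (Fintype.card_pos : 0 < Fintype.card A)
  have hK1 : (1 : ℝ) ≤ K := by exact_mod_cast hK
  have hH1 : (1 : ℝ) ≤ H := by exact_mod_cast hH
  have hb1 : 1 / 2 ≤ b := by nlinarith
  set R := √((Fintype.card S : ℝ) ^ 2 * Fintype.card A * K * ι ^ 2) with hR
  have hlog : Real.log (2 / δ) ≤ R := by
    refine (log_two_div_le_logTerm S A hH hK hδ).trans (Real.le_sqrt_of_sq_le ?_)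
    refine le_mul_of_one_le_left (sq_nonneg _) ?_
    exact one_le_mul_of_one_le_of_one_le (one_le_mul_of_one_le_of_one_le
      (one_le_pow₀ hS) hA) hK1
  -- The pigeonhole bound has only one power of the logarithmic term ι under the root; ι ≤ 4ι², from
  -- ι ≥ 1/2, brings it to the stated form.
  have hsq : √(b * (Fintype.card S * Fintype.card A * K)) ≤ 2 * R := by
    rw [hR, show (2 : ℝ) = √(2 ^ 2) by rw [Real.sqrt_sq (by norm_num)],
      ← Real.sqrt_mul (by positivity)]
    refine Real.sqrt_le_sqrt ?_
    have h1 : 0 ≤ (Fintype.card S : ℝ) ^ 2 * Fintype.card A * K := by positivity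
    rw [hb]
    nlinarith [mul_le_mul_of_nonneg_left (show ι ≤ 2 ^ 2 * ι ^ 2 by nlinarith) h1]
  have hpath : ∑ k : Fin K, pathUncertainty alg b k (history D k) (D k).state ≤ 120 * R := by
    simp only [pathUncertainty, ← Finset.sum_div]
    rw [div_le_iff₀ (by linarith), Finset.sum_comm]
    calc _ ≤ ∑ _h : Fin H, 120 * R := Finset.sum_le_sum fun h _ => by
          have h1 := sum_uncertainty_le (b := b) (by linarith) D h
          simp only [Episode.action, hpol, Episode.at] at h1
          linarith
      _ = _ := by simp; ring
  have hgap : ∀ k : Fin K, M.optValue β ((D k).state 0) - M.value β (D k).policy ((D k).state 0) ≤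
      55 * H ^ 2 * expect (M.episodeLaw (alg k (history D k)) ((D k).state 0))
        (pathUncertainty alg b k (history D k)) := fun k => by
    obtain ⟨w, Q, V, E, hπ⟩ := halg k (history D k)
    rw [hpol k]
    refine (E.optValue_sub_value_le hβ hH hβH hb1 (hacc k) hπ _).trans_eq ?_
    have : pathUncertainty alg b k (history D k) = fun x => (H : ℝ)⁻¹ * ∑ h, uncertainty b
        (visits (history D k) h (x h.castSucc) (alg k (history D k) h (x h.castSucc))) := by
      funext x; rw [pathUncertainty, div_eq_inv_mul]
    rw [this, expect_const_mul]
    field_simp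
    rfl
  have hfinal : √((H : ℝ) ^ 3 * (Fintype.card S : ℝ) ^ 2 * (Fintype.card A : ℝ) *
      ((K : ℝ) * H) * ι ^ 2) = H ^ 2 * R := by
    rw [show (H : ℝ) ^ 3 * (Fintype.card S : ℝ) ^ 2 * (Fintype.card A : ℝ) *
      ((K : ℝ) * H) * ι ^ 2 = (H ^ 2) ^ 2 * ((Fintype.card S : ℝ) ^ 2 * Fintype.card A * K * ι ^ 2)
      by ring, Real.sqrt_mul (by positivity), Real.sqrt_sq (by positivity)]
  have hR0 : 0 ≤ R := Real.sqrt_nonneg _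
  rw [hfinal]
  calc regret M β D ≤ ∑ k : Fin K, 55 * (H : ℝ) ^ 2 *
        expect (M.episodeLaw (alg k (history D k)) ((D k).state 0))
          (pathUncertainty alg b k (history D k)) := Finset.sum_le_sum fun k _ => hgap k
    _ = 55 * (H : ℝ) ^ 2 * ∑ k : Fin K,
        expect (M.episodeLaw (alg k (history D k)) ((D k).state 0))
          (pathUncertainty alg b k (history D k)) := (Finset.mul_sum _ _ _).symm
    -- 242 = 2 · 120 + 2, from the doubled realized sum and the additive 2 log(2/δ); then 55 · 242 =
    -- 13310 ≤ 14000.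
    _ ≤ 55 * (H : ℝ) ^ 2 * (242 * R) := by gcongr; linarith
    _ ≤ _ := by nlinarith [mul_nonneg (sq_nonneg (H : ℝ)) hR0]

theorem regret_bound [Nonempty S] (halg : IsRSVI M K 10 δ β alg) (hβ : β ≠ 0)
    (hH : 0 < H) (hβH : |β| * H ≤ 1) (hK : 0 < K) (hδ : 0 < δ) (hδ1 : δ ≤ 1)
    (env : (n : ℕ) → (Fin n → Episode S A H) → PMF S) :
    ENNReal.ofReal (1 - δ) ≤ (runLaw M alg env K).toOuterMeasure {D | regret M β D ≤
      14000 * √((H : ℝ) ^ 3 * (Fintype.card S : ℝ) ^ 2 * (Fintype.card A : ℝ) *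
        ((K : ℝ) * H) * logTerm S A H K δ ^ 2)} := by
  set p := runLaw M alg env K with hp
  set ι := logTerm S A H K δ with hι
  set G := {D : Fin K → Episode S A H | regret M β D ≤
      14000 * √((H : ℝ) ^ 3 * (Fintype.card S : ℝ) ^ 2 * (Fintype.card A : ℝ) *
        ((K : ℝ) * H) * ι ^ 2)} with hG
  have hι1 : 1 / 2 ≤ ι := half_le_logTerm S A hH hK hδ hδ1
  have hS : (0 : ℝ) < Fintype.card S := by exact_mod_cast (Fintype.card_pos : 0 < Fintype.card S)
  have h1 := (toOuterMeasure_not_accurate_le (M := M) (alg := alg) (env := env)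
    (L := 3 * (Fintype.card S * ι)) (by positivity) K).trans
      (ENNReal.ofReal_le_ofReal (failure_probability_le S A hH hK hδ hδ1))
  have h2 := toOuterMeasure_mean_le (M := M) (alg := alg) (env := env)
    (pathUncertainty alg (Fintype.card S * ι)) (pathUncertainty_nonneg _)
    (pathUncertainty_le_one _) K (2 * Real.log (2 / δ))
  rw [mul_div_cancel_left₀ _ two_ne_zero, ← Real.log_inv, Real.exp_log (by positivity),
    inv_div] at h2
  set B₁ := {D : Fin K → Episode S A H | ¬ ∀ k, Accurate M (3 * (Fintype.card S * ι)) (history D k)}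
  set B₂ := {D : Fin K → Episode S A H |
    2 * ∑ k : Fin K, pathUncertainty alg (Fintype.card S * ι) k (history D k) (D k).state +
      2 * Real.log (2 / δ) <
      ∑ k : Fin K, expect (M.episodeLaw (alg k (history D k)) ((D k).state 0))
        (pathUncertainty alg (Fintype.card S * ι) k (history D k))}
  -- The covering holds only on the support, because the recorded policies agree with those of `alg`
  -- only there. The two bad events have probability at most δ/2 each.
  have hcover : p.support ⊆ G ∪ (B₁ ∪ B₂) := fun D hD => by
    by_contra hnot
    rw [Set.mem_union, Set.mem_union, not_or, not_or] at hnot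
    obtain ⟨hG', h1', h2'⟩ := hnot
    exact hG' (regret_le_of_accurate halg hβ hH hβH hK hδ hδ1
      (policy_of_runLaw_ne_zero ((PMF.mem_support_iff _ _).1 hD)) (not_not.1 h1') (not_lt.1 h2'))
  have htotal : 1 ≤ p.toOuterMeasure G + ENNReal.ofReal δ := by
    calc (1 : ENNReal) = p.toOuterMeasure (G ∪ (B₁ ∪ B₂)) :=
          ((p.toOuterMeasure_apply_eq_one_iff _).2 hcover).symm
      _ ≤ p.toOuterMeasure G + (p.toOuterMeasure B₁ + p.toOuterMeasure B₂) :=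
          (MeasureTheory.measure_union_le _ _).trans
            (by gcongr; exact MeasureTheory.measure_union_le _ _)
      _ ≤ p.toOuterMeasure G + (ENNReal.ofReal (δ / 2) + ENNReal.ofReal (δ / 2)) := by gcongr
      _ = _ := by rw [← ENNReal.ofReal_add (by positivity) (by positivity), add_halves]
  rw [ENNReal.ofReal_sub _ hδ.le, ENNReal.ofReal_one]
  exact tsub_le_iff_right.2 htotal

end Regret

/-! ### The limit of λ and the range of β -/

/-- `λ(|β|H²) → 3` as `β → 0`. -/
theorem tendsto_lam {H : ℕ} (hH : 0 < H) :
    Tendsto (fun β : ℝ => lam (|β| * (H : ℝ) ^ 2)) (𝓝[≠] 0) (𝓝 3) := by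
  have hd : HasDerivAt (fun u : ℝ => Real.exp (3 * u)) 3 0 := by
    simpa using ((hasDerivAt_id (0 : ℝ)).const_mul 3).exp
  -- λ is the difference quotient of e^{3u} at 0, so its limit is the derivative there.
  have hslope : Tendsto lam (𝓝[≠] 0) (𝓝 3) := by
    refine (hasDerivAt_iff_tendsto_slope.1 hd).congr fun u => ?_
    simp [slope_def_field, lam]
  refine hslope.comp (tendsto_nhdsWithin_iff.2 ⟨?_, ?_⟩)
  · have : ContinuousAt (fun β : ℝ => |β| * (H : ℝ) ^ 2) 0 := by fun_prop
    have h := this.tendsto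
    simp only [abs_zero, zero_mul] at h
    exact h.mono_left nhdsWithin_le_nhds
  · filter_upwards [self_mem_nhdsWithin] with β hβ
    have : β ≠ 0 := hβ
    have hH' : (0 : ℝ) < H := by exact_mod_cast hH
    exact (mul_pos (abs_pos.2 this) (by positivity)).ne'

/-- The only smallness required of β; it depends on H alone. -/
theorem eventually_abs_mul_le_one (H : ℕ) : ∀ᶠ β : ℝ in 𝓝[≠] 0, β ≠ 0 ∧ |β| * H ≤ 1 := by
  refine (eventually_mem_nhdsWithin).and (eventually_nhdsWithin_of_eventually_nhds ?_)
  have : ContinuousAt (fun β : ℝ => |β| * (H : ℝ)) 0 := by fun_prop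
  exact (this.eventually_lt continuousAt_const (by simp)).mono fun _ h => h.le

end RiskRL

theorem corollary1 :
    (∀ H : ℕ, 0 < H →
      Tendsto (fun β : ℝ => RiskRL.lam (|β| * (H : ℝ) ^ 2)) (𝓝[≠] 0) (𝓝 3)) ∧
    ∃ c : ℝ, 0 < c ∧ ∃ C : ℝ, 0 < C ∧
      ∀ H : ℕ, 0 < H → ∀ᶠ β : ℝ in 𝓝[≠] 0,
        ∀ (S A : Type*) [Fintype S] [Fintype A] [Nonempty S] [Nonempty A]
          (M : RiskRL.EpisodicMDP S A H) (K : ℕ) (_ : 0 < K) (δ : ℝ) (_ : 0 < δ) (_ : δ ≤ 1)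
          (alg : (n : ℕ) → (Fin n → RiskRL.Episode S A H) → RiskRL.Policy S A H)
          (_ : RiskRL.IsRSVI M K c δ β alg)
          (env : (n : ℕ) → (Fin n → RiskRL.Episode S A H) → PMF S),
          ENNReal.ofReal (1 - δ) ≤ (RiskRL.runLaw M alg env K).toOuterMeasure
            {D | RiskRL.regret M β D ≤
              C * √((H : ℝ) ^ 3 * (Fintype.card S : ℝ) ^ 2 * (Fintype.card A : ℝ) *
                ((K : ℝ) * H) *
                Real.log (2 * Fintype.card S * Fintype.card A * ((K : ℝ) * H) / δ) ^ 2)} := by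
  refine ⟨fun H hH => RiskRL.tendsto_lam hH, 10, by norm_num, 14000, by norm_num, fun H hH => ?_⟩
  filter_upwards [RiskRL.eventually_abs_mul_le_one H] with β hβ
  intro S A _ _ _ _ M K hK δ hδ hδ1 alg halg env
  exact RiskRL.regret_bound halg hβ.1 hH hβ.2 hK hδ hδ1 env
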